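/- **Theorem 3.1.** Let $d\ge 1$ and let $\Omega$ be either (i) a periodic cell $\prod_{i=1}^d[0,L_i)\subset\mathbb R^d$ with all $L_i>0$ (periodic boundary conditions), or (ii) a bounded connected open subset of $\mathbb R^d$ with Lipschitz boundary (no-flux boundary conditions $\partial_{\mathbf n}\rho=\partial_{\mathbf n}\mu=0$ on $\partial\Omega$). Write $H^1(\Omega)$ for the usual Sobolev space, consisting of periodic functions in case (i), and $(\cdot,\cdot)$ for the $L^2(\Omega)$ inner product. Let $\beta,\eta,M_\rho,\delta t>0$ and $\theta,\rho_s\in\mathbb R$, and let $\rho^n,V^n\in L^2(\Omega)$ and $\phi^n\in H^1(\Omega)$ be given. Put $$G^n=\rho^n-\tfrac{\rho_s}{2},\qquad P(\rho)=-\beta\Delta\rho+\tfrac{2}{\eta^2}(G^n)^2\rho,\qquad g_1^n=\tfrac1{\eta^2}G^n\,(V^n-2G^n\rho^n)-\theta|\nabla\phi^n|^2 ,$$ and assume that the given data make the terms of the equations meaningful in $H^1(\Omega)$: for every $\psi\in H^1(\Omega)$, $G^n\psi\in L^2(\Omega)$ and $g_1^n\psi\in L^1(\Omega)$. 1. The linear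 system $$\tfrac1{\delta t}\rho^{n+1}=M_\rho\Delta\mu_\rho^{n+1}+\tfrac1{\delta t}\rho^n,\qquad \mu_\rho^{n+1}=P(\rho^{n+1})+g_1^n$$ with the boundary conditions (i) or (ii) has exactly one weak solution $(\rho^{n+1},\mu_\rho^{n+1})\in H^1(\Omega)\times H^1(\Omega)$; that is, for all $\psi\in H^1(\Omega)$, $$\tfrac1{\delta t}(\rho^{n+1},\psi)=-M_\rho(\nabla\mu_\rho^{n+1},\nabla\psi)+\tfrac1{\delta t}(\rho^n,\psi),\qquad (\mu_\rho^{n+1},\psi)=\beta(\nabla\rho^{n+1},\nabla\psi)+\tfrac2{\eta^2}((G^n)^2\rho^{n+1},\psi)+(g_1^n,\psi).$$ 2. For every $u\in L^2(\Omega)$ with $\int_\Omega u\,dx=0$ there is exactly one $v=:\Delta^{-1}u\in H^1(\Omega)$ with $\int_\Omega v\,dx=0$ and $-(\nabla v,\nabla\psi)=(u,\psi)$ for all $\psi\in H^1(\Omega)$. 3. Let $\dot H^1=\{\rho\in H^1(\Omega):\int_\Omega\rho\,dx=0\}$. The operator $\mathbb A=-\frac1{M_\rho\delta t}\Delta^{-1}+P$,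 defined by $$(\mathbb A\rho,\psi)=-\tfrac1{M_\rho\delta t}(\Delta^{-1}\rho,\psi)+\beta(\nabla\rho,\nabla\psi)+\tfrac2{\eta^2}((G^n)^2\rho,\psi),\qquad \rho,\psi\in\dot H^1,$$ is a bounded linear operator from $\dot H^1$ to its dual. It is the operator of the system above: if $V_\rho$ denotes the mean value of $\rho^n$ over $\Omega$, then $\hat\rho=\rho^{n+1}-V_\rho$ belongs to $\dot H^1$ and, for all $\psi\in\dot H^1$, $$(\mathbb A\hat\rho,\psi)=-\big(\Delta^{-1}\tfrac{1}{M_\rho\delta t}(\rho^n-V_\rho),\psi\big)-\big(g_1^n+\tfrac2{\eta^2}(G^n)^2V_\rho,\psi\big).$$ It is symmetric, $(\mathbb A\rho_1,\rho_2)=(\mathbb A\rho_2,\rho_1)$, and positive definite, $(\mathbb A\rho,\rho)>0$ for $\rho\neq0$; moreover there is $c>0$ with $(\mathbb A\rho,\rho)\ge c\|\rho\|_{H^1}^2$ for all $\rho\in\dot H^1$. -/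

import Mathlib

open MeasureTheory Set
open scoped ContDiff

noncomputable section

namespace Surfactant

/-- Physical space `ℝᵈ` with the Euclidean norm. -/
abbrev Space (d : ℕ) : Type := EuclideanSpace ℝ (Fin d)

/-- `Ω` has a Lipschitz boundary: near each boundary point, `Ω` is the region strictly above the
graph of a Lipschitz function. The vertical direction is the unit vector `e`, and `γ` is a function
of the variables orthogonal to `e`, that is, it is constant along `e`. -/
def HasLipschitzBoundary {d : ℕ} (Ω : Set (Space d)) : Prop :=
  ∀ x ∈ frontier Ω, ∃ (e : Space d) (r : ℝ) (K : NNReal) (γ : Space d → ℝ),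
    ‖e‖ = 1 ∧ 0 < r ∧ LipschitzWith K γ ∧ (∀ (y : Space d) (t : ℝ), γ (y + t • e) = γ y) ∧
      ∀ y ∈ Metric.ball x r, y ∈ Ω ↔ γ y < inner ℝ e y

/-- A bounded (nonempty) connected open set with Lipschitz boundary. -/
structure IsLipschitzDomain {d : ℕ} (Ω : Set (Space d)) : Prop where
  isOpen : IsOpen Ω
  isConnected : IsConnected Ω
  isBounded : Bornology.IsBounded Ω
  boundary : HasLipschitzBoundary Ω

/-- The computational domain together with the type of boundary conditions: either a periodic cell
with period `L i` in the `i`-th coordinate direction, or a bounded Lipschitz domain on whose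
boundary the no-flux (homogeneous Neumann) conditions are imposed. -/
inductive FlowDomain (d : ℕ) : Type
  | periodic (L : Fin d → ℝ) (hL : ∀ i, 0 < L i) : FlowDomain d
  | noFlux (Ω : Set (Space d)) (hΩ : IsLipschitzDomain Ω) : FlowDomain d

namespace FlowDomain

variable {d : ℕ}

/-- The underlying set `Ω`; in the periodic case it is a fundamental cell. -/
def carrier : FlowDomain d → Set (Space d)
  | periodic L _ => {x | ∀ i, x i ∈ Ico 0 (L i)}
  | noFlux Ω _ => Ω

/-- Lebesgue measure on `Ω`. -/
def meas (B : FlowDomain d) : Measure (Space d) := volume.restrict B.carrier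

/-- The test functions in the definition of weak derivatives: smooth periodic functions in the
periodic case, and smooth functions with compact support in `Ω` in the no-flux case. -/
def IsTest : FlowDomain d → (Space d → ℝ) → Prop
  | periodic L _, φ =>
      ContDiff ℝ ∞ φ ∧ ∀ (i : Fin d) (x : Space d), φ (x + EuclideanSpace.single i (L i)) = φ x
  | noFlux Ω _, φ => ContDiff ℝ ∞ φ ∧ HasCompactSupport φ ∧ tsupport φ ⊆ Ω

/-- The Hilbert space `L²(Ω)`. -/
abbrev L2 (B : FlowDomain d) : Type := Lp ℝ 2 B.meas

/-- The Hilbert space `L²(Ω; ℝᵈ)` of square integrable vector fields. -/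
abbrev L2Vec (B : FlowDomain d) : Type := Lp (Space d) 2 B.meas

/-- The partial derivative `∂φ/∂xᵢ` of a differentiable function. -/
def partialDeriv (i : Fin d) (φ : Space d → ℝ) (x : Space d) : ℝ :=
  fderiv ℝ φ x (EuclideanSpace.single i 1)

/-- `g` is the weak gradient of `u`. -/
def IsWeakGradient (B : FlowDomain d) (u : B.L2) (g : B.L2Vec) : Prop :=
  ∀ φ : Space d → ℝ, B.IsTest φ → ∀ i : Fin d,
    ∫ x, u x * partialDeriv i φ x ∂B.meas = -∫ x, (g x) i * φ x ∂B.meas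

theorem isBounded_carrier (B : FlowDomain d) : Bornology.IsBounded B.carrier := by
  cases B with
  | noFlux Ω hΩ => exact hΩ.isBounded
  | periodic L hL =>
    rw [isBounded_iff_forall_norm_le]
    refine ⟨∑ i, L i, fun x hx => ?_⟩
    have h0 : ∀ i, 0 ≤ x i := fun i => (hx i).1
    have h1 : ∀ i, x i ≤ L i := fun i => (hx i).2.le
    have hS : 0 ≤ ∑ i, L i := Finset.sum_nonneg fun i _ => (hL i).le
    rw [EuclideanSpace.norm_eq]
    refine Real.sqrt_le_iff.2 ⟨hS, ?_⟩
    calc ∑ i, ‖x i‖ ^ 2 ≤ ∑ i, L i * ∑ j, L j := by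
          refine Finset.sum_le_sum fun i _ => ?_
          have h2 : L i ≤ ∑ j, L j :=
            Finset.single_le_sum (f := L) (fun j _ => (hL j).le) (Finset.mem_univ i)
          rw [Real.norm_eq_abs, sq_abs, sq]
          exact mul_le_mul (h1 i) ((h1 i).trans h2) (h0 i) (hL i).le
      _ = (∑ i, L i) ^ 2 := by rw [← Finset.sum_mul, sq]

instance (B : FlowDomain d) : IsFiniteMeasure B.meas :=
  ⟨by
    rw [meas, Measure.restrict_apply_univ]
    exact B.isBounded_carrier.measure_lt_top⟩

theorem memLp_of_continuous (B : FlowDomain d) {f : Space d → ℝ} (hf : Continuous f) :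
    MemLp f 2 B.meas := by
  have hK : IsCompact (closure B.carrier) := B.isBounded_carrier.isCompact_closure
  obtain ⟨C, hC⟩ := hK.exists_bound_of_continuousOn hf.continuousOn
  refine MemLp.of_bound hf.aestronglyMeasurable C ?_
  have h : ∀ᵐ x ∂(volume.restrict (closure B.carrier)), ‖f x‖ ≤ C :=
    (ae_restrict_iff' isClosed_closure.measurableSet).2 (Filter.Eventually.of_forall hC)
  exact ae_restrict_of_ae_restrict_of_subset subset_closure h

theorem IsTest.contDiff {B : FlowDomain d} {φ : Space d → ℝ} (h : B.IsTest φ) :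
    ContDiff ℝ ∞ φ := by
  cases B with
  | noFlux Ω hΩ => exact h.1
  | periodic L hL => exact h.1

theorem IsTest.memLp {B : FlowDomain d} {φ : Space d → ℝ} (h : B.IsTest φ) :
    MemLp φ 2 B.meas :=
  B.memLp_of_continuous h.contDiff.continuous

theorem IsTest.memLp_partialDeriv {B : FlowDomain d} {φ : Space d → ℝ} (h : B.IsTest φ)
    (i : Fin d) : MemLp (partialDeriv i φ) 2 B.meas :=
  B.memLp_of_continuous
    ((h.contDiff.continuous_fderiv (by simp)).clm_apply continuous_const)

theorem memLp_coord (B : FlowDomain d) (g : B.L2Vec) (i : Fin d) :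
    MemLp (fun x => (g x) i) 2 B.meas :=
  (EuclideanSpace.proj (𝕜 := ℝ) i : Space d →L[ℝ] ℝ).comp_memLp' (Lp.memLp g)

/-- The Sobolev space `H¹(Ω)` (of periodic functions in the periodic case), realized as the space of
pairs `(u, ∇u)` of a function in `L²(Ω)` and its weak gradient in `L²(Ω; ℝᵈ)`. It inherits the
norm `‖u‖² + ‖∇u‖²` (squared) and the inner product of the product space. -/
def H1 (B : FlowDomain d) : Submodule ℝ (WithLp 2 (B.L2 × B.L2Vec)) where
  carrier := {p | B.IsWeakGradient p.fst p.snd}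
  zero_mem' := by
    intro φ _ i
    have h1 : ∫ x, ((0 : B.L2) x) * partialDeriv i φ x ∂B.meas = 0 := by
      rw [integral_eq_zero_of_ae]
      filter_upwards [Lp.coeFn_zero ℝ 2 B.meas] with x hx
      rw [hx]; simp
    have h2 : ∫ x, ((0 : B.L2Vec) x) i * φ x ∂B.meas = 0 := by
      rw [integral_eq_zero_of_ae]
      filter_upwards [Lp.coeFn_zero (Space d) 2 B.meas] with x hx
      rw [hx]; simp
    change ∫ x, ((0 : B.L2) x) * partialDeriv i φ x ∂B.meas
      = -∫ x, ((0 : B.L2Vec) x) i * φ x ∂B.meas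
    rw [h1, h2, neg_zero]
  add_mem' := by
    intro p q hp hq φ hφ i
    have h1 : ∫ x, ((p.fst + q.fst : B.L2) x) * partialDeriv i φ x ∂B.meas
        = ∫ x, p.fst x * partialDeriv i φ x ∂B.meas
          + ∫ x, q.fst x * partialDeriv i φ x ∂B.meas := by
      refine Eq.trans (integral_congr_ae ?_) (integral_add ((Lp.memLp p.fst).integrable_mul (hφ.memLp_partialDeriv i))
        ((Lp.memLp q.fst).integrable_mul (hφ.memLp_partialDeriv i)))
      filter_upwards [Lp.coeFn_add p.fst q.fst] with x hx
      rw [hx]; simp [add_mul]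
    have h2 : ∫ x, ((p.snd + q.snd : B.L2Vec) x) i * φ x ∂B.meas
        = ∫ x, (p.snd x) i * φ x ∂B.meas + ∫ x, (q.snd x) i * φ x ∂B.meas := by
      refine Eq.trans (integral_congr_ae ?_) (integral_add ((B.memLp_coord p.snd i).integrable_mul hφ.memLp)
        ((B.memLp_coord q.snd i).integrable_mul hφ.memLp))
      filter_upwards [Lp.coeFn_add p.snd q.snd] with x hx
      rw [hx]; simp [add_mul]
    change ∫ x, ((p.fst + q.fst : B.L2) x) * partialDeriv i φ x ∂B.meas
      = -∫ x, ((p.snd + q.snd : B.L2Vec) x) i * φ x ∂B.meas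
    rw [h1, h2, hp φ hφ i, hq φ hφ i, neg_add]
  smul_mem' := by
    intro c p hp φ hφ i
    have h1 : ∫ x, ((c • p.fst : B.L2) x) * partialDeriv i φ x ∂B.meas
        = c * ∫ x, p.fst x * partialDeriv i φ x ∂B.meas := by
      rw [← integral_const_mul]
      refine integral_congr_ae ?_
      filter_upwards [Lp.coeFn_smul c p.fst] with x hx
      rw [hx]; simp [mul_assoc]
    have h2 : ∫ x, ((c • p.snd : B.L2Vec) x) i * φ x ∂B.meas
        = c * ∫ x, (p.snd x) i * φ x ∂B.meas := by
      rw [← integral_const_mul]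
      refine integral_congr_ae ?_
      filter_upwards [Lp.coeFn_smul c p.snd] with x hx
      rw [hx]; simp [mul_assoc]
    change ∫ x, ((c • p.fst : B.L2) x) * partialDeriv i φ x ∂B.meas
      = -∫ x, ((c • p.snd : B.L2Vec) x) i * φ x ∂B.meas
    rw [h1, h2, hp φ hφ i, mul_neg]

variable {B : FlowDomain d}

/-- The function underlying an element of `H¹(Ω)`. -/
def fn (u : B.H1) : Space d → ℝ := (u.1.fst : B.L2)

/-- The weak gradient of an element of `H¹(Ω)`. -/
def grad (u : B.H1) : Space d → Space d := (u.1.snd : B.L2Vec)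

/-- The `L²` inner product of two real functions on `Ω`. -/
def pair (B : FlowDomain d) (f g : Space d → ℝ) : ℝ := ∫ x, f x * g x ∂B.meas

/-- The `L²` inner product `(∇u, ∇v)` of two weak gradients. -/
def dirichlet (u v : B.H1) : ℝ := ∫ x, inner ℝ (grad u x) (grad v x) ∂B.meas

/-- The subspace of the functions in `H¹(Ω)` with mean zero. -/
def H1MeanZero (B : FlowDomain d) : Submodule ℝ B.H1 where
  carrier := {u | ∫ x, fn u x ∂B.meas = 0}
  zero_mem' := by
    change ∫ x, ((0 : B.L2) x) ∂B.meas = 0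
    rw [integral_eq_zero_of_ae (Lp.coeFn_zero ℝ 2 B.meas)]
  add_mem' := by
    intro u v hu hv
    change ∫ x, ((u.1.fst + v.1.fst : B.L2) x) ∂B.meas = 0
    rw [integral_congr_ae (Lp.coeFn_add u.1.fst v.1.fst)]
    change ∫ x, (u.1.fst x + v.1.fst x) ∂B.meas = 0
    rw [integral_add ((Lp.memLp u.1.fst).integrable (by norm_num))
      ((Lp.memLp v.1.fst).integrable (by norm_num))]
    change ∫ x, fn u x ∂B.meas + ∫ x, fn v x ∂B.meas = 0
    rw [show ∫ x, fn u x ∂B.meas = 0 from hu, show ∫ x, fn v x ∂B.meas = 0 from hv, add_zero]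
  smul_mem' := by
    intro c u hu
    change ∫ x, ((c • u.1.fst : B.L2) x) ∂B.meas = 0
    rw [integral_congr_ae (Lp.coeFn_smul c u.1.fst)]
    change ∫ x, c • u.1.fst x ∂B.meas = 0
    rw [integral_smul]
    change c • ∫ x, fn u x ∂B.meas = 0
    rw [show ∫ x, fn u x ∂B.meas = 0 from hu, smul_zero]

/-- `v` is a weak solution of `Δ v = u` in `Ω` with mean zero, under the periodic or the no-flux
boundary condition. -/
def IsInvLaplacian (u : Space d → ℝ) (v : B.H1) : Prop :=
  ∫ x, fn v x ∂B.meas = 0 ∧ ∀ ψ : B.H1, -dirichlet v ψ = B.pair u (fn ψ)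

open Classical in
/-- The inverse Laplacian `Δ⁻¹ u` (with the irrelevant value `0` where `Δ v = u` has no solution). -/
def invLaplacian (B : FlowDomain d) (u : Space d → ℝ) : B.H1 :=
  if h : ∃ v : B.H1, IsInvLaplacian u v then h.choose else 0

end FlowDomain

open FlowDomain

variable {d : ℕ} {B : FlowDomain d}

/-- The coefficient `Gⁿ = ρⁿ - ρₛ / 2`. -/
def coeffG (ρs : ℝ) (ρn : B.L2) : Space d → ℝ := fun x => ρn x - ρs / 2

/-- The source `g₁ⁿ = η⁻² Gⁿ Dⁿ - θ |∇φⁿ|²` with `Dⁿ = Vⁿ - 2 Gⁿ ρⁿ`. -/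
def sourceG (η θ ρs : ℝ) (ρn Vn : B.L2) (φn : B.H1) : Space d → ℝ := fun x =>
  1 / η ^ 2 * coeffG ρs ρn x * (Vn x - 2 * coeffG ρs ρn x * ρn x) - θ * ‖grad φn x‖ ^ 2

/-- The weak form `(P(ρ), ψ)` of the operator `P(ρ) = -β Δρ + (2 / η²) (Gⁿ)² ρ`. -/
def formP (β η : ℝ) (G : Space d → ℝ) (ρ ψ : B.H1) : ℝ :=
  β * dirichlet ρ ψ + 2 / η ^ 2 * B.pair (fun x => G x ^ 2 * fn ρ x) (fn ψ)

/-- `(ρ, μ)` is a weak solution, with periodic or no-flux boundary conditions, of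
`ρ / δt = M Δμ + ρⁿ / δt` and `μ = P(ρ) + g₁ⁿ`. -/
structure IsWeakSolution (β η θ ρs M δt : ℝ) (ρn Vn : B.L2) (φn ρ μ : B.H1) : Prop where
  mass : ∀ ψ : B.H1,
    1 / δt * B.pair (fn ρ) (fn ψ) = -M * dirichlet μ ψ + 1 / δt * B.pair ρn (fn ψ)
  potential : ∀ ψ : B.H1,
    B.pair (fn μ) (fn ψ)
      = formP β η (coeffG ρs ρn) ρ ψ + B.pair (sourceG η θ ρs ρn Vn φn) (fn ψ)

/-- The weak form `(𝔸 ρ, ψ)` of `𝔸 ρ = -(M δt)⁻¹ Δ⁻¹ ρ + P(ρ)`. -/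
def formA (β η M δt : ℝ) (G : Space d → ℝ) (ρ ψ : B.H1) : ℝ :=
  -(1 / (M * δt)) * B.pair (fn (B.invLaplacian (fn ρ))) (fn ψ) + formP β η G ρ ψ

/-- The mean value `V_ρ` of `ρⁿ` over `Ω`. -/
def meanValue (ρn : B.L2) : ℝ := ⨍ x, ρn x ∂B.meas

/-- The right-hand side `(b, ψ)` of the reduced equation `𝔸 ρ̂ = b`, where `b = -Δ⁻¹ f - g`,
`f = (M δt)⁻¹ (ρⁿ - V_ρ)` and `g = g₁ⁿ + (2 / η²) (Gⁿ)² V_ρ`. -/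
def rhsB (η θ ρs M δt : ℝ) (ρn Vn : B.L2) (φn ψ : B.H1) : ℝ :=
  -B.pair (fn (B.invLaplacian (fun x => 1 / (M * δt) * (ρn x - meanValue ρn)))) (fn ψ)
    - B.pair (fun x => sourceG η θ ρs ρn Vn φn x
        + 2 / η ^ 2 * coeffG ρs ρn x ^ 2 * meanValue ρn) (fn ψ)

end Surfactant

end

/-!
Everything rests on the Poincaré–Wirtinger inequality `‖u‖ ≤ C ‖∇u‖` for functions of mean zero
(`exists_norm_fst_sq_le`), on a periodic cell and on a bounded connected Lipschitz domain alike.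

It is derived from one estimate (`IsSobolevPair.lintegral_translate_sub_le`): the `L²` norm of
`u(· + h) - u` on an open set `W` is at most `|h| ‖∇u‖` if the segments `[x, x + h]`, `x ∈ W`, lie
in the domain. It follows from the definition of weak derivatives by duality with test functions
on `W`, without approximation of `u` by smooth functions. Integrated over all `h`, it gives the
inequality on bounded convex open sets (`exists_lintegral_sub_const_le_of_convex`), which settles
the periodic case, as test functions on the open cell can be continued periodically. On a
connected open set, it carries the inequality, always with the same constant subtracted, from one
ball to a neighbourhood of every interior point. Finally, a piece of a Lipschitz domain near a
boundary point can be moved into a compact subset of the domain, which brings the inequality up to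
the boundary, and compactness of the closure finishes the proof (`exists_lintegral_sub_const_le`).

Given this, the Dirichlet form is coercive on functions of mean zero, so that the inverse
Laplacian exists and is bounded by Lax–Milgram. Since `-(Δ⁻¹ρ, ψ) = (∇Δ⁻¹ρ, ∇Δ⁻¹ψ)`, the form of
`𝔸` is symmetric and bounded below by that of `-β Δ`, hence coercive (`exists_clm_formA`). Its
boundedness and that of the right-hand side come from the closed graph theorem (`exists_clm_mul`),
which turns the integrability assumptions on the data into bounds. The mass equation says that `ρ`
has the mean value of `ρⁿ` and that `μ` is an inverse Laplacian up to a constant; inserted into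
the equation for the potential, this leaves the reduced equation for `ρ - V_ρ`, and one scalar
equation for the mean value of `μ` (`isWeakSolution_iff`).
-/

noncomputable section

namespace Surfactant

open Filter Topology
open scoped ENNReal NNReal

/-! ### The translation estimate and convex sets -/

section

theorem abs_integral_mul_le_eLpNorm {α : Type*} [MeasurableSpace α] {μ : Measure α} {f g : α → ℝ}
    (hf : MemLp f 2 μ) (hg : MemLp g 2 μ) :
    |∫ x, f x * g x ∂μ| ≤ (eLpNorm f 2 μ).toReal * (eLpNorm g 2 μ).toReal := by
  have h := abs_real_inner_le_norm (hf.toLp f) (hg.toLp g)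
  rw [Lp.norm_toLp, Lp.norm_toLp, L2.inner_def] at h
  refine le_trans (le_of_eq ?_) h
  congr 1
  refine integral_congr_ae ?_
  filter_upwards [hf.coeFn_toLp, hg.coeFn_toLp] with x h1 h2
  rw [h1, h2]
  simp [mul_comm]

/-- `u` and `g`, functions on the whole space, are square integrable and `g` is the weak gradient of
`u` in the open set `Ω`. In the applications they are extensions by zero of functions on `Ω`, so
that all integrals can be taken over the whole space, where translations act; nothing but square
integrability is asked of `g` outside `Ω`. Measurability of `u` (not only almost everywhere) is
required for the use of Tonelli's theorem. -/
structure IsSobolevPair {d : ℕ} (Ω : Set (Space d)) (u : Space d → ℝ) (g : Space d → Space d) :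
    Prop where
  measurable : Measurable u
  integrable : Integrable u
  memLp : MemLp u 2
  memLp_grad : MemLp g 2
  weak : ∀ φ : Space d → ℝ, ContDiff ℝ ∞ φ → HasCompactSupport φ → tsupport φ ⊆ Ω →
    ∀ h : Space d, ∫ x, u x * fderiv ℝ φ x h = -∫ x, inner ℝ (g x) h * φ x

variable {d : ℕ} {Ω : Set (Space d)} {u : Space d → ℝ} {g : Space d → Space d}

theorem toReal_eLpNorm_inner_const_le (hg : MemLp g 2) (h : Space d) :
    (eLpNorm (fun x => inner ℝ (g x) h) 2 volume).toReal ≤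
      ‖h‖ * (eLpNorm g 2 volume).toReal := by
  have h1 : eLpNorm (fun x => inner ℝ (g x) h) 2 volume
      ≤ ENNReal.ofReal ‖h‖ * eLpNorm g 2 volume := by
    refine eLpNorm_le_mul_eLpNorm_of_ae_le_mul (Eventually.of_forall fun x => ?_) 2
    rw [mul_comm]
    exact norm_inner_le_norm _ _
  have h2 := ENNReal.toReal_mono (ENNReal.mul_ne_top ENNReal.ofReal_ne_top hg.2.ne) h1
  rwa [ENNReal.toReal_mul, ENNReal.toReal_ofReal (norm_nonneg _)] at h2

/-- The translation estimate, tested against `φ`: the function `t ↦ ∫ u φ(· - t h)` has the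
derivative `∫ ⟪g, h⟫ φ(· - t h)` as long as the translates of `φ` are test functions in `Ω`. -/
theorem IsSobolevPair.abs_translate_pairing_le (hu : IsSobolevPair Ω u g) {h : Space d}
    {φ : Space d → ℝ} (hφ : ContDiff ℝ ∞ φ) (hc : HasCompactSupport φ)
    (hs : ∀ t ∈ Icc (0 : ℝ) 1, ∀ x ∈ tsupport φ, x + t • h ∈ Ω) :
    |(∫ x, u x * φ (x - h)) - ∫ x, u x * φ x| ≤
      ‖h‖ * (eLpNorm g 2 volume).toReal * (eLpNorm φ 2 volume).toReal := by
  set C : ℝ := ‖h‖ * (eLpNorm g 2 volume).toReal * (eLpNorm φ 2 volume).toReal with hC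
  have hφd : Differentiable ℝ φ := hφ.differentiable (by simp)
  have hφ' : Continuous (fderiv ℝ φ) := hφ.continuous_fderiv (by simp)
  have hmp : ∀ t : ℝ, MeasurePreserving (fun x : Space d => x - t • h) := fun t =>
    measurePreserving_sub_right volume (t • h)
  have hderiv : ∀ t : ℝ, HasDerivAt (fun t : ℝ => ∫ x, u x * φ (x - t • h))
      (∫ x, u x * fderiv ℝ φ (x - t • h) (-h)) t := by
    intro t
    obtain ⟨K, hK⟩ := hφ'.bounded_above_of_compact_support (hc.fderiv (𝕜 := ℝ))
    obtain ⟨K₀, hK₀⟩ := hφ.continuous.bounded_above_of_compact_support hc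
    refine (hasDerivAt_integral_of_dominated_loc_of_deriv_le (𝕜 := ℝ) (s := univ)
      (F := fun (t : ℝ) x => u x * φ (x - t • h))
      (F' := fun (t : ℝ) x => u x * fderiv ℝ φ (x - t • h) (-h))
      (bound := fun x => ‖u x‖ * (K * ‖h‖)) univ_mem ?_ ?_ ?_ ?_ ?_ ?_).2
    · refine Eventually.of_forall fun s => ?_
      exact hu.measurable.aestronglyMeasurable.mul
        (hφ.continuous.comp (continuous_id.sub continuous_const)).aestronglyMeasurable
    · refine hu.integrable.mul_bdd (c := K₀) ?_ (Eventually.of_forall fun x => hK₀ _)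
      exact (hφ.continuous.comp (continuous_id.sub continuous_const)).aestronglyMeasurable
    · exact hu.measurable.aestronglyMeasurable.mul
        ((hφ'.comp (continuous_id.sub continuous_const)).clm_apply
          continuous_const).aestronglyMeasurable
    · refine Eventually.of_forall fun x s _ => ?_
      rw [norm_mul]
      gcongr
      refine (ContinuousLinearMap.le_opNorm _ _).trans ?_
      rw [norm_neg]
      gcongr
      exact hK _
    · exact hu.integrable.norm.mul_const _
    · refine Eventually.of_forall fun x s _ => ?_
      refine HasDerivAt.const_mul _ ?_
      have h1 : HasDerivAt (fun s : ℝ => x - s • h) (-h) s := by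
        simpa using ((hasDerivAt_id s).smul_const h).const_sub x
      exact (hφd (x - s • h)).hasFDerivAt.comp_hasDerivAt s h1
  have hbound : ∀ t ∈ Ico (0 : ℝ) 1, ‖∫ x, u x * fderiv ℝ φ (x - t • h) (-h)‖ ≤ C := by
    intro t ht
    have hw := hu.weak (fun x => φ (x - t • h)) (hφ.comp (contDiff_id.sub contDiff_const))
      (hc.comp_homeomorph (Homeomorph.subRight (t • h))) (fun x hx => ?_) h
    · have e1 : ∀ x, fderiv ℝ (fun x => φ (x - t • h)) x = fderiv ℝ φ (x - t • h) :=
        fun x => by rw [fderiv_comp_sub]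
      simp only [e1] at hw
      simp only [map_neg, mul_neg, integral_neg, norm_neg]
      rw [hw, norm_neg, Real.norm_eq_abs]
      have hφ2 : MemLp φ 2 := hφ.continuous.memLp_of_hasCompactSupport hc
      refine (abs_integral_mul_le_eLpNorm (hu.memLp_grad.inner_const h)
        (hφ2.comp_measurePreserving (hmp t))).trans ?_
      have e2 : eLpNorm (fun x => φ (x - t • h)) 2 volume = eLpNorm φ 2 volume :=
        eLpNorm_comp_measurePreserving hφ2.1 (hmp t)
      rw [show (φ ∘ fun x => x - t • h) = fun x => φ (x - t • h) from rfl, e2]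
      exact mul_le_mul_of_nonneg_right (toReal_eLpNorm_inner_const_le hu.memLp_grad h)
        ENNReal.toReal_nonneg
    · have h2 : x - t • h ∈ tsupport φ := by
        have := tsupport_comp_subset_preimage φ (f := fun x : Space d => x - t • h)
          (by fun_prop) hx
        exact this
      simpa using hs t ⟨ht.1, ht.2.le⟩ _ h2
  have := norm_image_sub_le_of_norm_deriv_le_segment_01'
    (f := fun t : ℝ => ∫ x, u x * φ (x - t • h)) (fun t _ => (hderiv t).hasDerivWithinAt) hbound
  simp only [one_smul, zero_smul, sub_zero] at this
  rwa [Real.norm_eq_abs] at this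

/-- The `L²` norm on an open set by duality with smooth functions compactly supported in it, which
are dense since only `0` is orthogonal to all of them. -/
theorem eLpNorm_restrict_le_of_abs_integral_le {W : Set (Space d)} (hW : IsOpen W)
    {f : Space d → ℝ} (hf : MemLp f 2) {C : ℝ} (hC : 0 ≤ C)
    (h : ∀ φ : Space d → ℝ, ContDiff ℝ ∞ φ → HasCompactSupport φ → tsupport φ ⊆ W →
      |∫ x, f x * φ x| ≤ C * (eLpNorm φ 2 volume).toReal) :
    (eLpNorm f 2 (volume.restrict W)).toReal ≤ C := by
  have hfW : MemLp f 2 (volume.restrict W) := hf.restrict W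
  let T : Submodule ℝ (Lp ℝ 2 (volume.restrict W)) :=
    { carrier := {v | ∃ φ : Space d → ℝ, ContDiff ℝ ∞ φ ∧ HasCompactSupport φ ∧ tsupport φ ⊆ W ∧
        v =ᵐ[volume.restrict W] φ}
      zero_mem' := ⟨fun _ => 0, contDiff_const, HasCompactSupport.zero, by
        simp [tsupport], Lp.coeFn_zero _ _ _⟩
      add_mem' := by
        rintro v w ⟨φ, h1, h2, h3, h4⟩ ⟨ψ, k1, k2, k3, k4⟩
        refine ⟨φ + ψ, h1.add k1, h2.add k2, (tsupport_add _ _).trans (union_subset h3 k3), ?_⟩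
        exact (Lp.coeFn_add v w).trans (h4.add k4)
      smul_mem' := by
        rintro c v ⟨φ, h1, h2, h3, h4⟩
        refine ⟨c • φ, h1.const_smul c, h2.smul_left (f := fun _ => c),
          (closure_mono (Function.support_const_smul_subset c φ)).trans h3, ?_⟩
        exact (Lp.coeFn_smul c v).trans (h4.const_smul c) }
  have hT : T.topologicalClosure = ⊤ := by
    rw [Submodule.topologicalClosure_eq_top_iff, Submodule.eq_bot_iff]
    intro v hv
    have hv2 : LocallyIntegrableOn v W :=
      locallyIntegrableOn_of_locallyIntegrable_restrict
        ((Lp.memLp v).locallyIntegrable (by norm_num))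
    have := hW.ae_eq_zero_of_integral_contDiff_smul_eq_zero hv2 ?_
    · refine Lp.eq_zero_iff_ae_eq_zero.2 ((ae_restrict_iff' hW.measurableSet).2 this)
    · intro φ h1 h2 h3
      have hφ : MemLp φ 2 (volume.restrict W) :=
        h1.continuous.memLp_of_hasCompactSupport h2
      have h4 := (Submodule.mem_orthogonal T v).1 hv (hφ.toLp φ) ⟨φ, h1, h2, h3, hφ.coeFn_toLp⟩
      rw [L2.inner_def] at h4
      rw [← setIntegral_eq_integral_of_forall_compl_eq_zero (s := W), ← h4]
      · refine integral_congr_ae ?_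
        filter_upwards [hφ.coeFn_toLp] with x hx
        rw [hx]
        simp [mul_comm]
      · intro x hx
        rw [image_eq_zero_of_notMem_tsupport fun hx' => hx (h3 hx'), zero_smul]
  set F := hfW.toLp f with hF
  have hclosed : ∀ v : Lp ℝ 2 (volume.restrict W), |inner ℝ F v| ≤ C * ‖v‖ := by
    have hcl : IsClosed {v : Lp ℝ 2 (volume.restrict W) | |inner ℝ F v| ≤ C * ‖v‖} :=
      isClosed_le (by fun_prop) (by fun_prop)
    have hsub : (T : Set (Lp ℝ 2 (volume.restrict W))) ⊆ {v | |inner ℝ F v| ≤ C * ‖v‖} := by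
      rintro v ⟨φ, h1, h2, h3, h4⟩
      have hz : ∀ x, x ∉ W → φ x = 0 := fun x hx =>
        image_eq_zero_of_notMem_tsupport fun hx' => hx (h3 hx')
      have e1 : inner ℝ F v = ∫ x, f x * φ x := by
        have e3 : ∫ x in W, f x * φ x = ∫ x, f x * φ x :=
          setIntegral_eq_integral_of_forall_compl_eq_zero fun x hx => by rw [hz x hx, mul_zero]
        rw [← e3, L2.inner_def]
        refine integral_congr_ae ?_
        filter_upwards [hfW.coeFn_toLp, h4] with x hx hx'
        rw [hF, hx, hx']
        simp [mul_comm]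
      have e2 : ‖v‖ = (eLpNorm φ 2 volume).toReal := by
        rw [Lp.norm_def, eLpNorm_congr_ae h4, eLpNorm_restrict_eq_of_support_subset]
        exact (subset_tsupport φ).trans h3
      change |inner ℝ F v| ≤ C * ‖v‖
      rw [e1, e2]
      exact h φ h1 h2 h3
    intro v
    have h5 : v ∈ T.topologicalClosure := by rw [hT]; trivial
    exact closure_minimal hsub hcl h5
  have h6 := hclosed F
  rw [real_inner_self_eq_norm_sq, abs_of_nonneg (by positivity)] at h6
  have h7 : ‖F‖ = (eLpNorm f 2 (volume.restrict W)).toReal := Lp.norm_toLp _ _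
  rw [← h7]
  rcases (norm_nonneg F).eq_or_lt with h8 | h8
  · rw [← h8]
    exact hC
  · nlinarith

theorem eLpNorm_two_sq {α E : Type*} [MeasurableSpace α] [NormedAddCommGroup E] (μ : Measure α)
    (f : α → E) : eLpNorm f 2 μ ^ 2 = ∫⁻ x, ‖f x‖ₑ ^ 2 ∂μ := by
  have h := eLpNorm_nnreal_pow_eq_lintegral (f := f) (μ := μ) (p := 2) (by norm_num)
  simpa using h

/-- The translation estimate. No distance between `W` and the boundary of `Ω` is needed: it is
enough that the segments from `x` to `x + h` with `x ∈ W` lie in `Ω`. -/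
theorem IsSobolevPair.lintegral_translate_sub_le (hu : IsSobolevPair Ω u g) {W : Set (Space d)}
    (hW : IsOpen W) {h : Space d} (hs : ∀ t ∈ Icc (0 : ℝ) 1, ∀ x ∈ W, x + t • h ∈ Ω) :
    ∫⁻ x in W, ‖u (x + h) - u x‖ₑ ^ 2 ≤ ‖h‖ₑ ^ 2 * ∫⁻ x, ‖g x‖ₑ ^ 2 := by
  have hmp : MeasurePreserving (fun x : Space d => x + h) := measurePreserving_add_right volume h
  have hu' : MemLp (fun x => u (x + h)) 2 := hu.memLp.comp_measurePreserving hmp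
  have hf : MemLp (fun x => u (x + h) - u x) 2 := hu'.sub hu.memLp
  have key : (eLpNorm (fun x => u (x + h) - u x) 2 (volume.restrict W)).toReal ≤
      ‖h‖ * (eLpNorm g 2 volume).toReal := by
    refine eLpNorm_restrict_le_of_abs_integral_le hW hf (by positivity) fun φ h1 h2 h3 => ?_
    refine le_trans (le_of_eq ?_) (hu.abs_translate_pairing_le h1 h2
      fun t ht x hx => hs t ht x (h3 hx))
    have hφ : MemLp φ 2 := h1.continuous.memLp_of_hasCompactSupport h2
    have e1 : ∫ x, u x * φ (x - h) = ∫ x, u (x + h) * φ x := by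
      rw [← integral_add_right_eq_self _ h]
      simp
    have e2 : ∫ x, (u (x + h) * φ x - u x * φ x) = (∫ x, u (x + h) * φ x) - ∫ x, u x * φ x :=
      integral_sub (hu'.integrable_mul hφ) (hu.memLp.integrable_mul hφ)
    rw [e1, ← e2]
    simp only [sub_mul]
  rw [← eLpNorm_two_sq, ← eLpNorm_two_sq, ← mul_pow]
  gcongr
  rw [← ENNReal.toReal_le_toReal (hf.restrict W).2.ne (by finiteness [hu.memLp_grad.2.ne]),
    ENNReal.toReal_mul, toReal_enorm]
  exact key

/-- The Poincaré inequality on a bounded convex open set: by the translation estimate, applied to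
`V ∩ (V - h)` for every `h`, the double integral of `|u x - u y|²` over `V × V` is bounded by the
integral of `|g|²`, and then some value `c = u y` does at least as well as the average. -/
theorem exists_lintegral_sub_const_le_of_convex {V : Set (Space d)} (hV : IsOpen V)
    (hne : V.Nonempty) (hconv : Convex ℝ V) (hb : Bornology.IsBounded V) (hVΩ : V ⊆ Ω) :
    ∃ C : ℝ≥0, ∀ u g, IsSobolevPair Ω u g →
      ∃ c : ℝ, ∫⁻ x in V, ‖u x - c‖ₑ ^ 2 ≤ C * ∫⁻ x, ‖g x‖ₑ ^ 2 := by
  obtain ⟨R, hR⟩ := Metric.isBounded_iff.1 hb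
  obtain ⟨x₀, hx₀⟩ := hne
  have hR0 : 0 ≤ R := by simpa using hR hx₀ hx₀
  set D := Metric.closedBall (0 : Space d) R with hD
  have hDfin : volume D ≠ ⊤ := measure_closedBall_lt_top.ne
  have hVpos : volume V ≠ 0 := (hV.measure_pos volume ⟨x₀, hx₀⟩).ne'
  have hVfin : volume V ≠ ⊤ := hb.measure_lt_top.ne
  set C : ℝ≥0∞ := (volume D * ENNReal.ofReal R ^ 2) / volume V with hC
  have hCfin : C ≠ ⊤ := by
    rw [hC]; finiteness
  refine ⟨C.toNNReal, fun u g hu => ?_⟩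
  rw [ENNReal.coe_toNNReal hCfin]
  set N := ∫⁻ x, ‖g x‖ₑ ^ 2 with hN
  have hum := hu.measurable
  have hdouble : ∫⁻ y in V, ∫⁻ x in V, ‖u x - u y‖ₑ ^ 2 ≤ volume D * ENNReal.ofReal R ^ 2 * N := by
    set F : Space d → Space d → ℝ≥0∞ := fun x y =>
      V.indicator 1 x * V.indicator 1 y * ‖u x - u y‖ₑ ^ 2 with hF
    have hind : Measurable (V.indicator (1 : Space d → ℝ≥0∞)) :=
      measurable_one.indicator hV.measurableSet
    have e1 : ∫⁻ y in V, ∫⁻ x in V, ‖u x - u y‖ₑ ^ 2 = ∫⁻ y, ∫⁻ x, F x y := by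
      rw [← lintegral_indicator hV.measurableSet]
      refine lintegral_congr fun y => ?_
      by_cases hy : y ∈ V
      · rw [indicator_of_mem hy, ← lintegral_indicator hV.measurableSet]
        refine lintegral_congr fun x => ?_
        by_cases hx : x ∈ V <;> simp [hF, hx, hy]
      · simp [hF, hy]
    have e2 : ∀ y, ∫⁻ x, F x y = ∫⁻ h, F (y + h) y := fun y =>
      (lintegral_add_left_eq_self (fun x => F x y) y).symm
    have hFm : Measurable fun p : Space d × Space d => F (p.1 + p.2) p.1 := by
      have m1 : Measurable fun p : Space d × Space d => p.1 + p.2 := by fun_prop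
      exact ((hind.comp m1).mul (hind.comp measurable_fst)).mul
        (((hum.comp m1).sub (hum.comp measurable_fst)).enorm.pow_const 2)
    -- substitute `x = y + h` and integrate over `y` first
    simp_rw [e1, e2]
    rw [lintegral_lintegral_swap hFm.aemeasurable]
    have e3 : ∀ h, ∫⁻ y, F (y + h) y ≤ D.indicator (fun _ => ENNReal.ofReal R ^ 2 * N) h := by
      intro h
      set W : Set (Space d) := V ∩ (fun x => x + h) ⁻¹' V with hWdef
      have hW : IsOpen W := hV.inter (hV.preimage (by fun_prop))
      have e4 : ∫⁻ y, F (y + h) y = ∫⁻ y in W, ‖u (y + h) - u y‖ₑ ^ 2 := by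
        rw [← lintegral_indicator hW.measurableSet]
        refine lintegral_congr fun y => ?_
        by_cases h1 : y ∈ V <;> by_cases h2 : y + h ∈ V <;> simp [hF, hWdef, h1, h2, indicator]
      rw [e4]
      by_cases hh : h ∈ D
      · rw [indicator_of_mem hh]
        refine (hu.lintegral_translate_sub_le hW fun t ht x hx => ?_).trans ?_
        · refine hVΩ ?_
          have := hconv.add_smul_mem hx.1 hx.2 ht
          exact this
        · gcongr
          rw [← ofReal_norm]
          exact ENNReal.ofReal_le_ofReal (by simpa [hD] using hh)
      · have : W = ∅ := by
          refine eq_empty_of_forall_notMem fun x hx => hh ?_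
          have := hR hx.2 hx.1
          simpa [hD, dist_eq_norm] using this
        simp [this]
    refine (lintegral_mono e3).trans ?_
    rw [lintegral_indicator Metric.isClosed_closedBall.measurableSet, setLIntegral_const]
    exact le_of_eq (by ring)
  have hmeas : Measurable fun y => ∫⁻ x in V, ‖u x - u y‖ₑ ^ 2 := by
    refine Measurable.lintegral_prod_left'
      (f := fun p : Space d × Space d => ‖u p.1 - u p.2‖ₑ ^ 2) ?_
    exact ((hum.comp measurable_fst).sub (hum.comp measurable_snd)).enorm.pow_const 2
  obtain ⟨y, -, hy⟩ := exists_le_setLAverage hVpos hVfin hmeas.aemeasurable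
  refine ⟨u y, hy.trans ?_⟩
  rw [setLAverage_eq, hC, div_eq_mul_inv, div_eq_mul_inv]
  calc _ ≤ (volume D * ENNReal.ofReal R ^ 2 * N) * (volume V)⁻¹ := by gcongr
    _ = _ := by ring

end

/-! ### Propagation of the Poincaré inequality -/

section

variable {d : ℕ} {Ω : Set (Space d)}

/-- The Poincaré inequality for `W`, with the `L²` norm of the gradient taken over the whole space
and with a prescribed choice `c u g` of the constant to be subtracted. As the constant does not
depend on `W`, the property passes to finite unions. -/
def PoincareOn (Ω : Set (Space d)) (c : (Space d → ℝ) → (Space d → Space d) → ℝ)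
    (W : Set (Space d)) : Prop :=
  ∃ C : ℝ≥0, ∀ u g, IsSobolevPair Ω u g →
    ∫⁻ x in W, ‖u x - c u g‖ₑ ^ 2 ≤ C * ∫⁻ x, ‖g x‖ₑ ^ 2

namespace PoincareOn

variable {c : (Space d → ℝ) → (Space d → Space d) → ℝ} {W W' : Set (Space d)}

theorem mono (h : PoincareOn Ω c W') (hW : W ⊆ W') : PoincareOn Ω c W := by
  obtain ⟨C, hC⟩ := h
  exact ⟨C, fun u g hu => (lintegral_mono_set hW).trans (hC u g hu)⟩

theorem empty : PoincareOn Ω c ∅ := ⟨0, fun u g _ => by simp⟩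

theorem union (h : PoincareOn Ω c W) (h' : PoincareOn Ω c W') : PoincareOn Ω c (W ∪ W') := by
  obtain ⟨C, hC⟩ := h
  obtain ⟨C', hC'⟩ := h'
  refine ⟨C + C', fun u g hu => (lintegral_union_le _ _ _).trans ?_⟩
  rw [ENNReal.coe_add, add_mul]
  exact add_le_add (hC u g hu) (hC' u g hu)

/-- The Poincaré inequality passes from `W'` to `W` if `W` can be moved into `W'` by a translation
along segments in `Ω`. -/
theorem of_translate (h : PoincareOn Ω c W') (hW : IsOpen W) {v : Space d}
    (hs : ∀ t ∈ Icc (0 : ℝ) 1, ∀ x ∈ W, x + t • v ∈ Ω) (hv : ∀ x ∈ W, x + v ∈ W') :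
    PoincareOn Ω c W := by
  obtain ⟨C, hC⟩ := h
  refine ⟨4 * (C + ‖v‖₊ ^ 2), fun u g hu => ?_⟩
  have hum := hu.measurable
  have hsq : ∀ a b : ℝ≥0∞, (a + b) ^ 2 ≤ 4 * (a ^ 2 + b ^ 2) := by
    intro a b
    calc (a + b) ^ 2 ≤ (2 * max a b) ^ 2 := by
          rw [two_mul]; gcongr
          · exact le_max_left _ _
          · exact le_max_right _ _
      _ = 4 * (max a b) ^ 2 := by rw [mul_pow]; norm_num
      _ ≤ _ := by
          gcongr
          rcases max_choice a b with h | h <;> rw [h]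
          · exact le_self_add
          · exact le_add_self
  have h1 : ∫⁻ x in W, ‖u (x + v) - c u g‖ₑ ^ 2 ≤ C * ∫⁻ x, ‖g x‖ₑ ^ 2 := by
    refine le_trans ?_ (hC u g hu)
    have hmp : MeasurePreserving (fun x : Space d => x + v) := measurePreserving_add_right volume v
    have e := hmp.setLIntegral_comp_emb (MeasurableEquiv.addRight v).measurableEmbedding
      (fun x => ‖u x - c u g‖ₑ ^ 2) W
    refine e.trans_le ?_
    exact lintegral_mono_set (by rintro _ ⟨x, hx, rfl⟩; exact hv x hx)
  have h2 := hu.lintegral_translate_sub_le hW hs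
  calc ∫⁻ x in W, ‖u x - c u g‖ₑ ^ 2
      ≤ ∫⁻ x in W, 4 * (‖u (x + v) - c u g‖ₑ ^ 2 + ‖u (x + v) - u x‖ₑ ^ 2) := by
        refine lintegral_mono fun x => ?_
        refine le_trans ?_ (hsq _ _)
        gcongr
        have : u x - c u g = (u (x + v) - c u g) - (u (x + v) - u x) := by ring
        rw [this]
        exact enorm_sub_le
    _ = 4 * ((∫⁻ x in W, ‖u (x + v) - c u g‖ₑ ^ 2) + ∫⁻ x in W, ‖u (x + v) - u x‖ₑ ^ 2) := by
        rw [lintegral_const_mul _ (by fun_prop), lintegral_add_left (by fun_prop)]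
    _ ≤ 4 * (C * (∫⁻ x, ‖g x‖ₑ ^ 2) + ‖v‖ₑ ^ 2 * ∫⁻ x, ‖g x‖ₑ ^ 2) := by gcongr
    _ = _ := by
        rw [enorm_eq_nnnorm]
        push_cast
        ring

/-- In a connected open set, the Poincaré inequality spreads from one ball to small balls around
all points: the centres of such balls form a set that is open and relatively closed. -/
theorem exists_ball (hΩ : IsOpen Ω) (hconn : IsPreconnected Ω) {x₀ : Space d} (hx₀ : x₀ ∈ Ω)
    {r : ℝ} (hr : 0 < r) (h : PoincareOn Ω c (Metric.ball x₀ r)) :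
    ∀ x ∈ Ω, ∃ s > 0, PoincareOn Ω c (Metric.ball x s) := by
  set S : Set (Space d) := {x | ∃ s > 0, PoincareOn Ω c (Metric.ball x s)} with hS
  have hSo : IsOpen S := by
    rw [Metric.isOpen_iff]
    rintro x ⟨s, hs, hx⟩
    refine ⟨s, hs, fun y hy => ⟨s - dist y x, by simpa using hy, hx.mono ?_⟩⟩
    exact Metric.ball_subset_ball' (by simp)
  refine hconn.subset_of_closure_inter_subset hSo ⟨x₀, hx₀, r, hr, h⟩ ?_
  rintro x ⟨hxS, hxΩ⟩
  obtain ⟨ε, hε, hball⟩ := Metric.isOpen_iff.1 hΩ x hxΩ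
  obtain ⟨y, ⟨s, hs, hy⟩, hxy⟩ := Metric.mem_closure_iff.1 hxS (ε / 2) (half_pos hε)
  refine ⟨min s (ε / 2), lt_min hs (half_pos hε), hy.of_translate (v := y - x) Metric.isOpen_ball
    (fun t ht z hz => hball ?_) fun z hz => ?_⟩
  · have h1 : ‖z - x‖ < ε / 2 := by
      rw [← dist_eq_norm]; exact lt_of_lt_of_le hz (min_le_right _ _)
    have h2 : ‖t • (y - x)‖ ≤ ‖y - x‖ := by
      rw [norm_smul, Real.norm_of_nonneg ht.1]
      exact mul_le_of_le_one_left (norm_nonneg _) ht.2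
    rw [dist_comm, dist_eq_norm] at hxy
    rw [Metric.mem_ball, dist_eq_norm, show z + t • (y - x) - x = (z - x) + t • (y - x) by abel]
    linarith [norm_add_le (z - x) (t • (y - x))]
  · rw [Metric.mem_ball, dist_eq_norm, show z + (y - x) - y = z - x by abel, ← dist_eq_norm]
    exact lt_of_lt_of_le hz (min_le_left _ _)

end PoincareOn

/-- The Poincaré inequality on a bounded connected open set in which every piece near the boundary
can be moved, along segments in the set, into a compact subset. -/
theorem exists_lintegral_sub_const_le (hΩ : IsOpen Ω) (hconn : IsConnected Ω)
    (hb : Bornology.IsBounded Ω)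
    (hseg : ∀ x ∈ frontier Ω, ∃ U ∈ 𝓝 x, ∃ (v : Space d) (K : Set (Space d)), IsCompact K ∧ K ⊆ Ω ∧
      ∀ y ∈ U ∩ Ω, (∀ t ∈ Icc (0 : ℝ) 1, y + t • v ∈ Ω) ∧ y + v ∈ K) :
    ∃ C : ℝ≥0, ∀ u g, IsSobolevPair Ω u g →
      ∃ c : ℝ, ∫⁻ x in Ω, ‖u x - c‖ₑ ^ 2 ≤ C * ∫⁻ x, ‖g x‖ₑ ^ 2 := by
  obtain ⟨x₀, hx₀⟩ := hconn.nonempty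
  obtain ⟨r, hr, hball⟩ := Metric.isOpen_iff.1 hΩ x₀ hx₀
  obtain ⟨C₀, hC₀⟩ := exists_lintegral_sub_const_le_of_convex Metric.isOpen_ball
    ⟨x₀, Metric.mem_ball_self hr⟩ (convex_ball x₀ r) Metric.isBounded_ball hball
  -- the constant subtracted from `u` is fixed once and for all by the ball around `x₀`
  choose! c hc using hC₀
  have hloc := PoincareOn.exists_ball (c := c) hΩ hconn.isPreconnected hx₀ hr ⟨C₀, hc⟩
  have hcomp : ∀ K : Set (Space d), IsCompact K → K ⊆ Ω → PoincareOn Ω c K := by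
    intro K hK hKΩ
    refine hK.induction_on PoincareOn.empty (fun s t hst ht => ht.mono hst)
      (fun s t hs ht => hs.union ht) fun x hx => ?_
    obtain ⟨s, hs, h⟩ := hloc x (hKΩ hx)
    exact ⟨_, mem_nhdsWithin_of_mem_nhds (Metric.ball_mem_nhds x hs), h⟩
  have hall : PoincareOn Ω c (closure Ω ∩ Ω) := by
    refine hb.isCompact_closure.induction_on (p := fun s => PoincareOn Ω c (s ∩ Ω))
      (by simpa using PoincareOn.empty) (fun s t hst ht => ht.mono (inter_subset_inter_left _ hst))
      (fun s t hs ht => by rw [union_inter_distrib_right]; exact hs.union ht) fun x hx => ?_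
    by_cases hxΩ : x ∈ Ω
    · obtain ⟨s, hs, h⟩ := hloc x hxΩ
      exact ⟨_, mem_nhdsWithin_of_mem_nhds (Metric.ball_mem_nhds x hs), h.mono inter_subset_left⟩
    · obtain ⟨U, hU, v, K, hK, hKΩ, h⟩ := hseg x (by rw [hΩ.frontier_eq]; exact ⟨hx, hxΩ⟩)
      refine ⟨interior U, mem_nhdsWithin_of_mem_nhds (interior_mem_nhds.2 hU), ?_⟩
      have hUi : ∀ y ∈ interior U ∩ Ω, y ∈ U ∩ Ω := fun y hy => ⟨interior_subset hy.1, hy.2⟩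
      exact (hcomp K hK hKΩ).of_translate (v := v) (isOpen_interior.inter hΩ)
        (fun t ht y hy => (h y (hUi y hy)).1 t ht) (fun y hy => (h y (hUi y hy)).2)
  rw [inter_eq_right.2 subset_closure] at hall
  obtain ⟨C, hC⟩ := hall
  exact ⟨C, fun u g hu => ⟨c u g, hC u g hu⟩⟩

/-- Near a boundary point of a Lipschitz domain, moving upwards in the vertical direction `e` of the
graph stays in the domain, and after the distance `r / 4` one is above the graph by at least
`r / 4`, hence in a compact subset. -/
theorem IsLipschitzDomain.exists_translate (hΩ : IsLipschitzDomain Ω) :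
    ∀ x ∈ frontier Ω, ∃ U ∈ 𝓝 x, ∃ (v : Space d) (K : Set (Space d)), IsCompact K ∧ K ⊆ Ω ∧
      ∀ y ∈ U ∩ Ω, (∀ t ∈ Icc (0 : ℝ) 1, y + t • v ∈ Ω) ∧ y + v ∈ K := by
  intro x hx
  obtain ⟨e, r, L, γ, he, hr, hγ, hinv, hiff⟩ := hΩ.boundary x hx
  have hee : inner ℝ e e = 1 := by rw [real_inner_self_eq_norm_sq, he, one_pow]
  have hdist : ∀ y ∈ Metric.ball x (r / 2), ∀ t ∈ Icc (0 : ℝ) 1,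
      dist (y + t • (r / 4) • e) x ≤ 3 / 4 * r := by
    intro y hy t ht
    have h1 : ‖t • (r / 4) • e‖ ≤ r / 4 := by
      rw [norm_smul, norm_smul, he, Real.norm_of_nonneg ht.1, Real.norm_of_nonneg (by positivity),
        mul_one]
      exact mul_le_of_le_one_left (by positivity) ht.2
    rw [Metric.mem_ball, dist_eq_norm] at hy
    rw [dist_eq_norm, show y + t • (r / 4) • e - x = (y - x) + t • (r / 4) • e by abel]
    linarith [norm_add_le (y - x) (t • (r / 4) • e)]
  refine ⟨Metric.ball x (r / 2), Metric.ball_mem_nhds x (half_pos hr), (r / 4) • e,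
    Metric.closedBall x (3 / 4 * r) ∩ {z | γ z + r / 4 ≤ inner ℝ e z}, ?_, ?_, ?_⟩
  · refine (isCompact_closedBall _ _).inter_right (isClosed_le ?_ ?_)
    · exact hγ.continuous.add continuous_const
    · fun_prop
  · rintro z ⟨hz, hz'⟩
    refine (hiff z ?_).2 ?_
    · exact Metric.closedBall_subset_ball (by linarith) hz
    · have : γ z + r / 4 ≤ inner ℝ e z := hz'
      linarith
  · rintro y ⟨hy, hyΩ⟩
    have h0 : γ y < inner ℝ e y :=
      (hiff y (Metric.ball_subset_ball (by linarith) hy)).1 hyΩ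
    have h1 : ∀ t : ℝ, inner ℝ e (y + t • (r / 4) • e) = inner ℝ e y + t * (r / 4) := by
      intro t
      rw [inner_add_right, inner_smul_right, inner_smul_right, hee, mul_one]
    have h2 : ∀ t : ℝ, γ (y + t • (r / 4) • e) = γ y := by
      intro t
      rw [smul_smul]
      exact hinv y _
    refine ⟨fun t ht => (hiff _ ?_).2 ?_, ?_, ?_⟩
    · exact lt_of_le_of_lt (hdist y hy t ht) (by linarith)
    · rw [h1, h2]
      have : 0 ≤ t * (r / 4) := mul_nonneg ht.1 (by positivity)
      linarith
    · simpa using hdist y hy 1 (by simp)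
    · have h3 := h1 1
      have h4 := h2 1
      rw [one_smul, one_mul] at h3
      rw [one_smul] at h4
      change γ _ + r / 4 ≤ inner ℝ e _
      rw [h3, h4]
      linarith

end

/-! ### The Poincaré–Wirtinger inequality on flow domains -/

section

variable {d : ℕ}

/-- The interior of the periodic cell. -/
def openBox (L : Fin d → ℝ) : Set (Space d) := {x | ∀ i, x i ∈ Ioo 0 (L i)}

theorem isOpen_openBox (L : Fin d → ℝ) : IsOpen (openBox L) := by
  rw [openBox, ofPred_forall]
  refine isOpen_iInter_of_finite fun i => ?_
  exact isOpen_Ioo.preimage (f := fun x : Space d => x i) (by fun_prop)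

theorem convex_openBox (L : Fin d → ℝ) : Convex ℝ (openBox L) := by
  rw [openBox, ofPred_forall]
  refine convex_iInter fun i => ?_
  exact (convex_Ioo 0 (L i)).is_linear_preimage (f := fun x : Space d => x i)
    ⟨fun _ _ => rfl, fun _ _ => rfl⟩

theorem openBox_nonempty {L : Fin d → ℝ} (hL : ∀ i, 0 < L i) : (openBox L).Nonempty :=
  ⟨WithLp.toLp 2 fun i => L i / 2, fun i => ⟨half_pos (hL i), half_lt_self (hL i)⟩⟩

theorem openBox_ae_eq (L : Fin d → ℝ) :
    ({x : Space d | ∀ i, x i ∈ Ico 0 (L i)} : Set (Space d)) =ᵐ[volume] openBox L := by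
  have h : (univ.pi fun i => Ioo 0 (L i)) =ᵐ[(volume : Measure (Fin d → ℝ))]
      univ.pi fun i => Ico 0 (L i) :=
    Measure.univ_pi_Ioo_ae_eq_Icc.trans Measure.univ_pi_Ico_ae_eq_Icc.symm
  have h' := (EuclideanSpace.volume_preserving_symm_measurableEquiv_toLp
    (Fin d)).quasiMeasurePreserving.preimage_ae_eq h.symm
  have e1 : {x : Space d | ∀ i, x i ∈ Ico 0 (L i)} =
      (MeasurableEquiv.toLp 2 (Fin d → ℝ)).symm ⁻¹' univ.pi fun i => Ico 0 (L i) := by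
    ext x; simp
  have e2 : openBox L =
      (MeasurableEquiv.toLp 2 (Fin d → ℝ)).symm ⁻¹' univ.pi fun i => Ioo 0 (L i) := by
    ext x; simp [openBox]
  rw [e1, e2]
  exact h'

/-- The representative of `x` modulo the periods in the half-open cell. -/
def reduceToCell (L : Fin d → ℝ) (x : Space d) : Space d :=
  WithLp.toLp 2 fun i => x i - L i * ⌊x i / L i⌋

theorem reduceToCell_of_mem {L : Fin d → ℝ} {x : Space d} (hx : x ∈ openBox L) :
    reduceToCell L x = x := by
  ext i
  have h := hx i
  have : ⌊x i / L i⌋ = 0 := by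
    rw [Int.floor_eq_zero_iff]
    exact ⟨(div_pos h.1 (h.1.trans h.2)).le, (div_lt_one (h.1.trans h.2)).2 h.2⟩
  simp [reduceToCell, this]

theorem reduceToCell_add_period {L : Fin d → ℝ} (hL : ∀ i, 0 < L i) (i : Fin d) (x : Space d) :
    reduceToCell L (x + EuclideanSpace.single i (L i)) = reduceToCell L x := by
  ext j
  by_cases hj : j = i
  · subst hj
    have : (x j + L j) / L j = x j / L j + 1 := by
      field_simp [(hL j).ne']
    simp [reduceToCell, this]
    ring
  · simp [reduceToCell, hj]

/-- The periodization of a smooth function with compact support in the open cell is smooth. If some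
coordinate `x i` is a multiple of the period, it vanishes near `x`, because the support keeps a
distance from the faces of the cell; otherwise `reduceToCell` is a translation near `x`. -/
theorem contDiff_comp_reduceToCell {L : Fin d → ℝ} (hL : ∀ i, 0 < L i) {φ : Space d → ℝ}
    (hφ : ContDiff ℝ ∞ φ) (hc : HasCompactSupport φ) (hs : tsupport φ ⊆ openBox L) :
    ContDiff ℝ ∞ (fun x => φ (reduceToCell L x)) := by
  have hcoord : ∀ i, Continuous fun y : Space d => y i := fun i => by fun_prop
  refine contDiff_iff_contDiffAt.2 fun x => ?_
  by_cases hx : ∃ i, ∃ m : ℤ, x i = L i * m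
  · obtain ⟨i, m, him⟩ := hx
    obtain ⟨ε, hε, hK⟩ := hc.isCompact.exists_forall_le'
      (f := fun z : Space d => min (z i) (L i - z i))
      ((hcoord i).min (continuous_const.sub (hcoord i))).continuousOn (a := 0)
      (fun z hz => lt_min (hs hz i).1 (sub_pos.2 (hs hz i).2))
    have hev : ∀ᶠ y in 𝓝 x, φ (reduceToCell L y) = 0 := by
      have h1 : ∀ᶠ y in 𝓝 x, y i ∈ Ioo (x i - ε) (x i + ε) :=
        (hcoord i).continuousAt.eventually (Ioo_mem_nhds (by linarith) (by linarith))
      filter_upwards [h1] with y hy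
      by_contra hne
      have h2 := hK _ (subset_tsupport φ hne)
      have h3 : (reduceToCell L y) i = y i - L i * ⌊y i / L i⌋ := rfl
      rw [le_min_iff, h3] at h2
      rw [him] at hy
      set n := ⌊y i / L i⌋
      have h4 : 0 < L i * ((m - n : ℤ) : ℝ) := by push_cast; linarith [hy.2, h2.1]
      have h5 : L i * ((m - n : ℤ) : ℝ) < L i * 1 := by push_cast; linarith [hy.1, h2.2]
      have h6 : (0 : ℝ) < ((m - n : ℤ) : ℝ) := pos_of_mul_pos_right h4 (hL i).le
      have h7 : ((m - n : ℤ) : ℝ) < 1 := lt_of_mul_lt_mul_left h5 (hL i).le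
      norm_cast at h6 h7
      omega
    exact contDiffAt_const.congr_of_eventuallyEq hev
  · push Not at hx
    set k : Space d := WithLp.toLp 2 fun i => L i * ⌊x i / L i⌋ with hk
    have hev : ∀ᶠ y in 𝓝 x, φ (reduceToCell L y) = φ (y - k) := by
      have h1 : ∀ i, ∀ᶠ y in 𝓝 x, ⌊(y : Space d) i / L i⌋ = ⌊x i / L i⌋ := by
        intro i
        have h2 : x i / L i ∈ Ioo (⌊x i / L i⌋ : ℝ) (⌊x i / L i⌋ + 1) := by
          refine ⟨(Int.floor_le _).lt_of_ne fun h => hx i ⌊x i / L i⌋ ?_, Int.lt_floor_add_one _⟩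
          rw [h, mul_div_cancel₀ _ (hL i).ne']
        have h3 : Continuous fun y : Space d => y i / L i := (hcoord i).div_const _
        filter_upwards [h3.continuousAt.eventually (Ioo_mem_nhds h2.1 h2.2)] with y hy
        exact Int.floor_eq_iff.2 ⟨hy.1.le, hy.2⟩
      filter_upwards [eventually_all.2 h1] with y hy
      congr 1
      ext i
      simp [reduceToCell, hk, hy i]
    exact (hφ.comp (contDiff_id.sub contDiff_const)).contDiffAt.congr_of_eventuallyEq hev

namespace FlowDomain

/-- The domain up to a null set, as an open set: the open cell in the periodic case, and `Ω` in the
no-flux case. -/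
def openCarrier (B : FlowDomain d) : Set (Space d) :=
  match B with
  | periodic L _ => openBox L
  | noFlux Ω _ => Ω

theorem isOpen_openCarrier (B : FlowDomain d) : IsOpen B.openCarrier := by
  cases B with
  | periodic L hL => exact isOpen_openBox L
  | noFlux Ω hΩ => exact hΩ.isOpen

theorem carrier_ae_eq_openCarrier (B : FlowDomain d) : B.carrier =ᵐ[volume] B.openCarrier := by
  cases B with
  | periodic L hL => exact openBox_ae_eq L
  | noFlux Ω hΩ => exact EventuallyEq.rfl

theorem meas_eq_restrict_openCarrier (B : FlowDomain d) : B.meas = volume.restrict B.openCarrier :=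
  Measure.restrict_congr_set B.carrier_ae_eq_openCarrier

theorem openCarrier_nonempty (B : FlowDomain d) : B.openCarrier.Nonempty := by
  cases B with
  | periodic L hL => exact openBox_nonempty hL
  | noFlux Ω hΩ => exact hΩ.isConnected.nonempty

/-- Smooth functions with compact support in the open cell are restrictions of admissible test
functions, in the periodic case by periodization. -/
theorem exists_isTest_eqOn (B : FlowDomain d) {φ : Space d → ℝ} (hφ : ContDiff ℝ ∞ φ)
    (hc : HasCompactSupport φ) (hs : tsupport φ ⊆ B.openCarrier) :
    ∃ ψ, B.IsTest ψ ∧ EqOn ψ φ B.openCarrier := by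
  cases B with
  | periodic L hL =>
    refine ⟨fun x => φ (reduceToCell L x), ⟨contDiff_comp_reduceToCell hL hφ hc hs, fun i x => ?_⟩,
      fun x hx => ?_⟩
    · change φ _ = φ _
      rw [reduceToCell_add_period hL]
    · change φ _ = φ _
      rw [reduceToCell_of_mem hx]
  | noFlux Ω hΩ => exact ⟨φ, ⟨hφ, hc, hs⟩, fun _ _ => rfl⟩

theorem isSobolevPair (B : FlowDomain d) (u : B.H1) :
    IsSobolevPair B.openCarrier (B.openCarrier.indicator (fn u))
      (B.openCarrier.indicator (grad u)) := by
  have hm := B.isOpen_openCarrier.measurableSet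
  have hu2 : MemLp (fn u) 2 (volume.restrict B.openCarrier) := by
    rw [← meas_eq_restrict_openCarrier]; exact Lp.memLp u.1.fst
  have hg2 : MemLp (grad u) 2 (volume.restrict B.openCarrier) := by
    rw [← meas_eq_restrict_openCarrier]; exact Lp.memLp u.1.snd
  have hfin : IsFiniteMeasure (volume.restrict B.openCarrier) := by
    rw [← meas_eq_restrict_openCarrier]; infer_instance
  refine ⟨(Lp.stronglyMeasurable u.1.fst).measurable.indicator hm,
    (integrable_indicator_iff hm).2 (hu2.integrable (by norm_num)),
    (memLp_indicator_iff_restrict hm).2 hu2, (memLp_indicator_iff_restrict hm).2 hg2, ?_⟩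
  intro φ hφ hc hs h
  obtain ⟨ψ, hψ, heq⟩ := B.exists_isTest_eqOn hφ hc hs
  have e1 : ∫ x, B.openCarrier.indicator (fn u) x * fderiv ℝ φ x h =
      ∫ x, ∑ i, h i * (fn u x * partialDeriv i ψ x) ∂B.meas := by
    rw [meas_eq_restrict_openCarrier, ← integral_indicator hm]
    refine integral_congr_ae (Eventually.of_forall fun x => ?_)
    by_cases hx : x ∈ B.openCarrier
    · have e2 : fderiv ℝ φ x = fderiv ℝ ψ x :=
        (heq.eventuallyEq_of_mem (B.isOpen_openCarrier.mem_nhds hx)).fderiv_eq.symm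
      have e3 : h = ∑ i, h i • (EuclideanSpace.single i (1 : ℝ) : Space d) := by
        ext j; simp [Pi.single_apply]
      simp only [indicator_of_mem hx, e2, partialDeriv]
      conv_lhs => rw [e3]
      simp only [map_sum, map_smul, smul_eq_mul, Finset.mul_sum]
      exact Finset.sum_congr rfl fun i _ => by ring
    · simp [indicator_of_notMem hx]
  have e4 : ∫ x, inner ℝ (B.openCarrier.indicator (grad u) x) h * φ x =
      ∫ x, ∑ i, h i * ((grad u x) i * ψ x) ∂B.meas := by
    rw [meas_eq_restrict_openCarrier, ← integral_indicator hm]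
    refine integral_congr_ae (Eventually.of_forall fun x => ?_)
    by_cases hx : x ∈ B.openCarrier
    · simp only [indicator_of_mem hx, ← heq hx, PiLp.inner_apply, Finset.sum_mul]
      exact Finset.sum_congr rfl fun i _ => by simp; ring
    · simp [indicator_of_notMem hx]
  rw [e1, e4, integral_finsetSum, integral_finsetSum, ← Finset.sum_neg_distrib]
  · refine Finset.sum_congr rfl fun i _ => ?_
    rw [integral_const_mul, integral_const_mul, ← mul_neg]
    congr 1
    exact u.2 ψ hψ i
  · exact fun i _ => ((B.memLp_coord u.1.snd i).integrable_mul hψ.memLp).const_mul _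
  · exact fun i _ => ((Lp.memLp u.1.fst).integrable_mul (hψ.memLp_partialDeriv i)).const_mul _

theorem exists_lintegral_sub_const_le_openCarrier (B : FlowDomain d) :
    ∃ C : ℝ≥0, ∀ u g, IsSobolevPair B.openCarrier u g →
      ∃ c : ℝ, ∫⁻ x in B.openCarrier, ‖u x - c‖ₑ ^ 2 ≤ C * ∫⁻ x, ‖g x‖ₑ ^ 2 := by
  cases B with
  | periodic L hL =>
    refine exists_lintegral_sub_const_le_of_convex (isOpen_openBox L) (openBox_nonempty hL)
      (convex_openBox L) ?_ subset_rfl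
    refine (periodic L hL).isBounded_carrier.subset fun x hx i => ⟨(hx i).1.le, (hx i).2⟩
  | noFlux Ω hΩ =>
    exact exists_lintegral_sub_const_le hΩ.isOpen hΩ.isConnected hΩ.isBounded hΩ.exists_translate

/-- The Poincaré–Wirtinger inequality for both kinds of domains. For a function `u` of mean zero,
`u` is orthogonal to constants, so that `‖u‖ ≤ ‖u - c‖`. -/
theorem exists_norm_fst_sq_le (B : FlowDomain d) :
    ∃ C : ℝ, 0 < C ∧ ∀ u : B.H1, ∫ x, fn u x ∂B.meas = 0 →
      ‖u.1.fst‖ ^ 2 ≤ C * ‖u.1.snd‖ ^ 2 := by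
  obtain ⟨C, hC⟩ := B.exists_lintegral_sub_const_le_openCarrier
  refine ⟨C + 1, by positivity, fun u hu => ?_⟩
  obtain ⟨c, hc⟩ := hC _ _ (B.isSobolevPair u)
  have hm := B.isOpen_openCarrier.measurableSet
  have e1 : ∫⁻ x in B.openCarrier, ‖B.openCarrier.indicator (fn u) x - c‖ₑ ^ 2
      = eLpNorm (u.1.fst - Lp.const 2 B.meas c : B.L2) 2 B.meas ^ 2 := by
    have e3 : ∫⁻ x in B.openCarrier, ‖B.openCarrier.indicator (fn u) x - c‖ₑ ^ 2 =
        ∫⁻ x, ‖fn u x - c‖ₑ ^ 2 ∂B.meas := by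
      rw [meas_eq_restrict_openCarrier]
      exact setLIntegral_congr_fun hm fun x hx => by rw [indicator_of_mem hx]
    rw [e3, eLpNorm_two_sq]
    refine lintegral_congr_ae ?_
    filter_upwards [Lp.coeFn_sub u.1.fst (Lp.const 2 B.meas c), Lp.coeFn_const 2 B.meas c]
      with x h1 h2
    rw [h1, Pi.sub_apply, h2]
    rfl
  have e2 : ∫⁻ x, ‖B.openCarrier.indicator (grad u) x‖ₑ ^ 2 = eLpNorm u.1.snd 2 B.meas ^ 2 := by
    rw [← eLpNorm_two_sq, eLpNorm_indicator_eq_eLpNorm_restrict hm, ← meas_eq_restrict_openCarrier]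
    rfl
  rw [e1, e2] at hc
  have h3 := ENNReal.toReal_mono (by finiteness [(Lp.memLp u.1.snd).2.ne]) hc
  rw [ENNReal.toReal_mul, ENNReal.toReal_pow, ENNReal.toReal_pow, ← Lp.norm_def, ← Lp.norm_def,
    norm_sub_sq_real] at h3
  have h4 : inner ℝ u.1.fst (Lp.const 2 B.meas c : B.L2) = 0 := by
    rw [L2.inner_def]
    have : ∫ x, c * fn u x ∂B.meas = 0 := by rw [integral_const_mul, hu, mul_zero]
    rw [← this]
    refine integral_congr_ae ?_
    filter_upwards [Lp.coeFn_const 2 B.meas c] with x hx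
    rw [hx]
    rfl
  rw [h4, ENNReal.coe_toReal] at h3
  nlinarith [sq_nonneg ‖(Lp.const 2 B.meas c : B.L2)‖, sq_nonneg ‖u.1.snd‖]

end FlowDomain

end

/-! ### Constants, and completeness of the Sobolev space -/

section

variable {d : ℕ}

namespace FlowDomain

/-- The derivative of a periodic function has integral zero over the cell, by the divergence
theorem: the contributions of opposite faces cancel. -/
theorem integral_partialDeriv_cell {L : Fin d → ℝ} (hL : ∀ i, 0 < L i) {φ : Space d → ℝ}
    (hφ : ContDiff ℝ ∞ φ)
    (hper : ∀ (i : Fin d) (x : Space d), φ (x + EuclideanSpace.single i (L i)) = φ x) (i : Fin d) :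
    ∫ x in openBox L, partialDeriv i φ x = 0 := by
  obtain _ | n := d
  · exact i.elim0
  let e : (Fin (n + 1) → ℝ) →L[ℝ] Space (n + 1) :=
    (PiLp.continuousLinearEquiv 2 ℝ (fun _ : Fin (n + 1) => ℝ)).symm
  have hcont : Continuous (partialDeriv i φ) :=
    (hφ.continuous_fderiv (by simp)).clm_apply continuous_const
  have h1 : ∫ x in openBox L, partialDeriv i φ x = ∫ y in Icc 0 L, partialDeriv i φ (e y) := by
    have hmp := (PiLp.volume_preserving_toLp (Fin (n + 1)))
    have hemb : MeasurableEmbedding (WithLp.toLp 2 : (Fin (n + 1) → ℝ) → Space (n + 1)) :=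
      (MeasurableEquiv.toLp 2 (Fin (n + 1) → ℝ)).measurableEmbedding
    rw [← hmp.setIntegral_preimage_emb hemb]
    have hpre : (WithLp.toLp 2 : (Fin (n + 1) → ℝ) → Space (n + 1)) ⁻¹' openBox L =
        univ.pi fun j => Ioo ((0 : Fin (n + 1) → ℝ) j) (L j) := by
      ext y; simp [openBox]
    have hpi : (univ.pi fun j => Ioo ((0 : Fin (n + 1) → ℝ) j) (L j)) =ᵐ[volume] Icc 0 L :=
      Measure.univ_pi_Ioo_ae_eq_Icc
    rw [hpre, setIntegral_congr_set hpi]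
    rfl
  rw [h1]
  have key := integral_divergence_of_hasFDerivAt_off_countable' (E := ℝ) 0 L
    (fun j => (hL j).le)
    (fun j y => if j = i then φ (e y) else 0)
    (fun j y => if j = i then (fderiv ℝ φ (e y)).comp e else 0) ∅ countable_empty
    (fun j => ?_) (fun y _ j => ?_) ?_
  · have e1 : ∀ y : Fin (n + 1) → ℝ, (∑ j : Fin (n + 1),
        (if j = i then (fderiv ℝ φ (e y)).comp e else 0 : (Fin (n + 1) → ℝ) →L[ℝ] ℝ)
          (Pi.single j 1)) = partialDeriv i φ (e y) := by
      intro y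
      rw [Finset.sum_eq_single i (fun j _ hj => by simp [hj]) (by simp)]
      simp only [if_true]
      rfl
    simp only [e1] at key
    rw [key]
    refine Finset.sum_eq_zero fun j _ => ?_
    by_cases hj : j = i
    · subst hj
      simp only [if_true]
      rw [sub_eq_zero]
      refine integral_congr_ae (Eventually.of_forall fun y => ?_)
      have e2 : e (j.insertNth (L j) y) =
          e (j.insertNth ((0 : Fin (n + 1) → ℝ) j) y) + EuclideanSpace.single j (L j) := by
        ext k
        induction k using j.succAboveCases with
        | x => simp [e]
        | p k => simp [e]
      simp only [e2, hper]
    · simp [hj]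
  · by_cases hj : j = i
    · simp only [hj, if_true]
      exact (hφ.continuous.comp e.continuous).continuousOn
    · simp only [hj, if_false]
      exact continuousOn_const
  · by_cases hj : j = i
    · simp only [hj, if_true]
      exact ((hφ.differentiable (by simp)) (e y)).hasFDerivAt.comp y e.hasFDerivAt
    · simp only [hj, if_false]
      exact hasFDerivAt_const _ _
  · refine (Continuous.integrableOn_Icc ?_)
    refine continuous_finsetSum _ fun j _ => ?_
    by_cases hj : j = i
    · simp only [hj, if_true]
      exact ((hφ.continuous_fderiv (by simp)).comp e.continuous).clm_apply continuous_const
    · simp only [hj, if_false]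
      exact continuous_const

/-- This says that constants have weak gradient zero, also with respect to periodic test
functions. -/
theorem IsTest.integral_partialDeriv {B : FlowDomain d} {φ : Space d → ℝ} (h : B.IsTest φ)
    (i : Fin d) : ∫ x, partialDeriv i φ x ∂B.meas = 0 := by
  cases B with
  | periodic L hL =>
    rw [meas_eq_restrict_openCarrier]
    exact integral_partialDeriv_cell hL h.1 h.2 i
  | noFlux Ω hΩ =>
    obtain ⟨h1, h2, h3⟩ := h
    have e1 : ∫ x, partialDeriv i φ x ∂(noFlux Ω hΩ).meas = ∫ x, partialDeriv i φ x := by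
      refine setIntegral_eq_integral_of_forall_compl_eq_zero fun x hx => ?_
      have : fderiv ℝ φ x = 0 := by
        refine image_eq_zero_of_notMem_tsupport fun hx' => hx (h3 ?_)
        exact tsupport_fderiv_subset ℝ hx'
      rw [partialDeriv, this]
      rfl
    have hi : Integrable (partialDeriv i φ) := by
      refine Continuous.integrable_of_hasCompactSupport
        ((h1.continuous_fderiv (by simp)).clm_apply continuous_const) ?_
      exact h2.fderiv_apply (𝕜 := ℝ) _
    -- integration by parts on the whole space against the constant `1`
    have := integral_mul_fderiv_eq_neg_fderiv_mul_of_integrable (𝕜 := ℝ) (μ := volume)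
      (f := fun _ : Space d => (1 : ℝ)) (g := φ) (v := EuclideanSpace.single i 1)
      (by simp) (by simp only [one_mul]; exact hi)
      (by simpa using h1.continuous.integrable_of_hasCompactSupport h2)
      (fun x _ => differentiableAt_const _) (fun x _ => h1.differentiable (by simp) x)
    rw [e1]
    simpa [partialDeriv] using this

/-- The constant function `1` as an element of `H¹(Ω)`. -/
def oneH1 (B : FlowDomain d) : B.H1 :=
  ⟨WithLp.toLp 2 (Lp.const 2 B.meas 1, 0), by
    intro φ hφ i
    have h1 : ∫ x, (Lp.const 2 B.meas (1 : ℝ) : B.L2) x * partialDeriv i φ x ∂B.meas = 0 := by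
      rw [← hφ.integral_partialDeriv i]
      refine integral_congr_ae ?_
      filter_upwards [Lp.coeFn_const 2 B.meas (1 : ℝ)] with x hx
      rw [hx, Function.const_apply, one_mul]
    have h3 : ∫ x, ((0 : B.L2Vec) x) i * φ x ∂B.meas = 0 := by
      refine integral_eq_zero_of_ae ?_
      filter_upwards [Lp.coeFn_zero (Space d) 2 B.meas] with x hx
      rw [hx]; simp
    change ∫ x, (Lp.const 2 B.meas (1 : ℝ) : B.L2) x * partialDeriv i φ x ∂B.meas
      = -∫ x, ((0 : B.L2Vec) x) i * φ x ∂B.meas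
    rw [h1, h3, neg_zero]⟩

theorem fn_oneH1 (B : FlowDomain d) : fn B.oneH1 =ᵐ[B.meas] fun _ => 1 :=
  Lp.coeFn_const 2 B.meas 1

theorem isClosed_H1 (B : FlowDomain d) : IsClosed (B.H1 : Set (WithLp 2 (B.L2 × B.L2Vec))) := by
  have h : (B.H1 : Set (WithLp 2 (B.L2 × B.L2Vec))) =
      {p | ∀ φ : Space d → ℝ, B.IsTest φ → ∀ i : Fin d, ∫ x, p.fst x * partialDeriv i φ x ∂B.meas
        = -∫ x, (p.snd x) i * φ x ∂B.meas} := rfl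
  rw [h]
  simp only [ofPred_forall]
  refine isClosed_iInter fun φ => isClosed_iInter fun hφ => isClosed_iInter fun i => ?_
  have e1 : ∀ p : WithLp 2 (B.L2 × B.L2Vec), ∫ x, p.fst x * partialDeriv i φ x ∂B.meas =
      inner ℝ (hφ.memLp_partialDeriv i).toLp p.fst := by
    intro p
    rw [L2.inner_def]
    refine integral_congr_ae ?_
    filter_upwards [(hφ.memLp_partialDeriv i).coeFn_toLp] with x hx
    rw [hx]; simp
  have hv : MemLp (fun x => φ x • EuclideanSpace.single i (1 : ℝ) : Space d → Space d) 2 B.meas :=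
    (ContinuousLinearMap.toSpanSingleton ℝ
      (EuclideanSpace.single i (1 : ℝ) : Space d)).comp_memLp' hφ.memLp
  have e2 : ∀ p : WithLp 2 (B.L2 × B.L2Vec), ∫ x, (p.snd x) i * φ x ∂B.meas =
      inner ℝ hv.toLp p.snd := by
    intro p
    rw [L2.inner_def]
    refine integral_congr_ae ?_
    filter_upwards [hv.coeFn_toLp] with x hx
    rw [hx, inner_smul_left, EuclideanSpace.inner_single_left]; simp [mul_comm]
  simp only [e1, e2]
  refine isClosed_eq ?_ ?_
  · exact continuous_const.inner (WithLp.fstL 2 ℝ B.L2 B.L2Vec).continuous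
  · exact (continuous_const.inner (WithLp.sndL 2 ℝ B.L2 B.L2Vec).continuous).neg

instance (B : FlowDomain d) : CompleteSpace B.H1 :=
  B.isClosed_H1.completeSpace_coe

end FlowDomain

end

/-! ### The inverse Laplacian -/

section

variable {d : ℕ}

/-- The bounded bilinear form `(v, w) ↦ ⟪S v, T w⟫`. -/
def innerComp {V W H : Type*} [NormedAddCommGroup V] [NormedSpace ℝ V] [NormedAddCommGroup W]
    [NormedSpace ℝ W] [NormedAddCommGroup H] [InnerProductSpace ℝ H] (S : V →L[ℝ] H)
    (T : W →L[ℝ] H) : V →L[ℝ] W →L[ℝ] ℝ :=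
  LinearMap.mkContinuous₂
    (LinearMap.mk₂ ℝ (fun v w => inner ℝ (S v) (T w))
      (fun _ _ _ => by rw [map_add, inner_add_left])
      (fun _ _ _ => by rw [map_smul, real_inner_smul_left, smul_eq_mul])
      (fun _ _ _ => by rw [map_add, inner_add_right])
      (fun _ _ _ => by rw [map_smul, real_inner_smul_right, smul_eq_mul]))
    (‖S‖ * ‖T‖) fun v w => by
      refine (norm_inner_le_norm (𝕜 := ℝ) (S v) (T w)).trans ?_
      calc ‖S v‖ * ‖T w‖ ≤ (‖S‖ * ‖v‖) * (‖T‖ * ‖w‖) := by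
            gcongr
            · exact S.le_opNorm v
            · exact T.le_opNorm w
        _ = _ := by ring

/-- The Lax–Milgram lemma for a functional in place of a vector. -/
theorem exists_forall_eq_of_coercive {V : Type*} [NormedAddCommGroup V] [InnerProductSpace ℝ V]
    [CompleteSpace V] {a : V →L[ℝ] V →L[ℝ] ℝ} {c : ℝ} (hc : 0 < c)
    (ha : ∀ v, c * ‖v‖ ^ 2 ≤ a v v) (l : V →L[ℝ] ℝ) : ∃ v, ∀ w, a v w = l w := by
  have hco : IsCoercive a := ⟨c, hc, fun v => by rw [mul_assoc, ← sq]; exact ha v⟩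
  refine ⟨hco.continuousLinearEquivOfBilin.symm ((InnerProductSpace.toDual ℝ V).symm l),
    fun w => ?_⟩
  rw [← hco.continuousLinearEquivOfBilin_apply, ContinuousLinearEquiv.apply_symm_apply,
    InnerProductSpace.toDual_symm_apply]

theorem exists_mem_forall_inner_eq {V H : Type*} [NormedAddCommGroup V] [InnerProductSpace ℝ V]
    [NormedAddCommGroup H] [InnerProductSpace ℝ H] (W : Submodule ℝ V) [CompleteSpace W]
    (S : V →L[ℝ] H) {c : ℝ} (hc : 0 < c) (hS : ∀ u : W, c * ‖u‖ ^ 2 ≤ ‖S u‖ ^ 2)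
    (l : V →L[ℝ] ℝ) : ∃ v ∈ W, ∀ w ∈ W, inner ℝ (S v) (S w) = l w := by
  obtain ⟨v, hv⟩ := exists_forall_eq_of_coercive
    (a := innerComp (S.comp W.subtypeL) (S.comp W.subtypeL)) hc
    (fun u => (hS u).trans (real_inner_self_eq_norm_sq (S u)).ge) (l.comp W.subtypeL)
  exact ⟨v, v.2, fun w hw => hv ⟨w, hw⟩⟩

namespace FlowDomain

variable {B : FlowDomain d}

/-- The embedding of `H¹(Ω)` into `L²(Ω)`. -/
def toL2 (B : FlowDomain d) : B.H1 →L[ℝ] B.L2 :=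
  (WithLp.fstL 2 ℝ B.L2 B.L2Vec).comp B.H1.subtypeL

/-- The weak gradient as a bounded operator from `H¹(Ω)` to `L²(Ω; ℝᵈ)`. -/
def gradL2 (B : FlowDomain d) : B.H1 →L[ℝ] B.L2Vec :=
  (WithLp.sndL 2 ℝ B.L2 B.L2Vec).comp B.H1.subtypeL

theorem norm_sq_eq (u : B.H1) : ‖u‖ ^ 2 = ‖B.toL2 u‖ ^ 2 + ‖B.gradL2 u‖ ^ 2 :=
  WithLp.prod_norm_sq_eq_of_L2 u.1

theorem gradL2_oneH1 : B.gradL2 B.oneH1 = 0 := rfl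

theorem inner_L2_eq_pair (v w : B.L2) : B.pair v w = inner ℝ v w := by
  rw [L2.inner_def, pair]
  exact integral_congr_ae (Eventually.of_forall fun x => by simp [mul_comm])

theorem pair_fn_eq_inner {f : Space d → ℝ} {v : B.L2} (h : v =ᵐ[B.meas] f) (ψ : B.H1) :
    B.pair f (fn ψ) = inner ℝ v (B.toL2 ψ) := by
  rw [← inner_L2_eq_pair]
  refine integral_congr_ae ?_
  filter_upwards [h] with x hx
  rw [hx]
  rfl

theorem pair_fn_fn (u ψ : B.H1) : B.pair (fn u) (fn ψ) = inner ℝ (B.toL2 u) (B.toL2 ψ) :=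
  pair_fn_eq_inner EventuallyEq.rfl ψ

theorem dirichlet_eq_inner (u ψ : B.H1) :
    dirichlet u ψ = inner ℝ (B.gradL2 u) (B.gradL2 ψ) := by
  rw [L2.inner_def]; rfl

theorem inner_oneH1 (v : B.L2) : inner ℝ v (B.toL2 B.oneH1) = ∫ x, v x ∂B.meas := by
  rw [← inner_L2_eq_pair]
  refine integral_congr_ae ?_
  filter_upwards [B.fn_oneH1] with x hx
  change v x * fn B.oneH1 x = _
  rw [hx, mul_one]

theorem mem_H1MeanZero_iff {u : B.H1} :
    u ∈ B.H1MeanZero ↔ inner ℝ (B.toL2 u) (B.toL2 B.oneH1) = 0 := by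
  rw [inner_oneH1]; rfl

instance (B : FlowDomain d) : CompleteSpace B.H1MeanZero := by
  have h : IsClosed (B.H1MeanZero : Set B.H1) := by
    have e : (B.H1MeanZero : Set B.H1) = {u | inner ℝ (B.toL2 u) (B.toL2 B.oneH1) = 0} := by
      ext u; exact mem_H1MeanZero_iff
    rw [e]
    exact isClosed_eq (by fun_prop) continuous_const
  exact h.completeSpace_coe

theorem inner_oneH1_oneH1_pos : 0 < inner ℝ (B.toL2 B.oneH1) (B.toL2 B.oneH1) := by
  rw [inner_oneH1]
  have : ∫ x, B.toL2 B.oneH1 x ∂B.meas = B.meas.real univ := by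
    refine (integral_congr_ae B.fn_oneH1).trans ?_
    simp
  rw [this, measureReal_def, meas_eq_restrict_openCarrier, Measure.restrict_apply_univ]
  refine ENNReal.toReal_pos (B.isOpen_openCarrier.measure_pos volume B.openCarrier_nonempty).ne' ?_
  rw [← Measure.restrict_apply_univ, ← meas_eq_restrict_openCarrier]
  exact measure_ne_top _ _

theorem exists_eq_add_smul_oneH1 (ψ : B.H1) :
    ∃ (ψ₀ : B.H1MeanZero) (c : ℝ), ψ = ψ₀ + c • B.oneH1 := by
  have h := (inner_oneH1_oneH1_pos (B := B)).ne'
  set c : ℝ := inner ℝ (B.toL2 ψ) (B.toL2 B.oneH1) / inner ℝ (B.toL2 B.oneH1) (B.toL2 B.oneH1)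
  refine ⟨⟨ψ - c • B.oneH1, mem_H1MeanZero_iff.2 ?_⟩, c, by simp⟩
  rw [map_sub, map_smul, inner_sub_left, real_inner_smul_left, div_mul_cancel₀ _ h, sub_self]

/-- The Poincaré–Wirtinger inequality: on functions of mean zero, the Dirichlet form is coercive for
the norm of `H¹(Ω)`. -/
theorem exists_norm_sq_le (B : FlowDomain d) :
    ∃ C : ℝ, 0 < C ∧ ∀ u : B.H1MeanZero, C * ‖u‖ ^ 2 ≤ ‖B.gradL2 u‖ ^ 2 := by
  obtain ⟨C, hC, h⟩ := B.exists_norm_fst_sq_le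
  refine ⟨(C + 1)⁻¹, by positivity, fun u => ?_⟩
  rw [inv_mul_le_iff₀ (by positivity)]
  have h1 : ‖B.toL2 u‖ ^ 2 ≤ C * ‖B.gradL2 u‖ ^ 2 := h u.1 u.2
  have h2 := norm_sq_eq u.1
  rw [Submodule.norm_coe] at h2
  rw [h2]
  linarith

theorem eq_of_gradL2_eq {u v : B.H1} (hu : u ∈ B.H1MeanZero) (hv : v ∈ B.H1MeanZero)
    (h : B.gradL2 u = B.gradL2 v) : u = v := by
  obtain ⟨C, hC, hP⟩ := B.exists_norm_sq_le
  have h1 := hP ⟨u - v, sub_mem hu hv⟩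
  rw [map_sub, h, sub_self, norm_zero] at h1
  have h2 : ‖(⟨u - v, sub_mem hu hv⟩ : B.H1MeanZero)‖ ^ 2 ≤ 0 := by
    by_contra! h3
    have := mul_pos hC h3
    linarith
  have h4 := norm_eq_zero.1 (sq_eq_zero_iff.1 (le_antisymm h2 (sq_nonneg _)))
  exact sub_eq_zero.1 (congrArg Subtype.val h4)

theorem eq_of_forall_inner_gradL2_eq {u v : B.H1} (hu : u ∈ B.H1MeanZero) (hv : v ∈ B.H1MeanZero)
    (h : ∀ ψ, inner ℝ (B.gradL2 u) (B.gradL2 ψ) = inner ℝ (B.gradL2 v) (B.gradL2 ψ)) : u = v := by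
  refine eq_of_gradL2_eq hu hv (sub_eq_zero.1 (inner_self_eq_zero (𝕜 := ℝ).1 ?_))
  rw [inner_sub_left, ← map_sub, h (u - v), sub_self]

theorem isInvLaplacian_iff {f : Space d → ℝ} {w : B.L2} (hw : w =ᵐ[B.meas] f) {v : B.H1} :
    IsInvLaplacian f v ↔
      v ∈ B.H1MeanZero ∧ ∀ ψ, -inner ℝ (B.gradL2 v) (B.gradL2 ψ) = inner ℝ w (B.toL2 ψ) := by
  simp only [← pair_fn_eq_inner hw, ← dirichlet_eq_inner]
  rfl

theorem IsInvLaplacian.unique {f : Space d → ℝ} {v v' : B.H1} (h : IsInvLaplacian f v)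
    (h' : IsInvLaplacian f v') : v = v' := by
  refine eq_of_forall_inner_gradL2_eq h.1 h'.1 fun ψ => ?_
  rw [← dirichlet_eq_inner, ← dirichlet_eq_inner]
  linarith [h.2 ψ, h'.2 ψ]

/-- Solvability of the Neumann or periodic problem `Δ v = f`. Lax–Milgram gives the weak equation
for test functions of mean zero; it holds for constants since `f` has mean zero. -/
theorem exists_isInvLaplacian {f : Space d → ℝ} (hf : MemLp f 2 B.meas)
    (h0 : ∫ x, f x ∂B.meas = 0) : ∃ v : B.H1, IsInvLaplacian f v := by
  obtain ⟨C, hC, hP⟩ := B.exists_norm_sq_le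
  set w := hf.toLp f with hw
  obtain ⟨v, hvW, hv⟩ := exists_mem_forall_inner_eq B.H1MeanZero B.gradL2 hC hP
    (-((innerSL ℝ w).comp B.toL2))
  refine ⟨v, (isInvLaplacian_iff hf.coeFn_toLp).2 ⟨hvW, fun ψ => ?_⟩⟩
  obtain ⟨ψ₀, c, rfl⟩ := exists_eq_add_smul_oneH1 ψ
  have h1 : inner ℝ (B.gradL2 v) (B.gradL2 ψ₀) = -inner ℝ w (B.toL2 ψ₀) := hv ψ₀ ψ₀.2
  have h2 : inner ℝ w (B.toL2 B.oneH1) = 0 := by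
    rw [inner_oneH1, integral_congr_ae hf.coeFn_toLp, h0]
  rw [map_add, map_add, map_smul, map_smul, gradL2_oneH1, smul_zero, add_zero, inner_add_right,
    real_inner_smul_right, h2, h1]
  ring

theorem isInvLaplacian_invLaplacian {f : Space d → ℝ} (hf : MemLp f 2 B.meas)
    (h0 : ∫ x, f x ∂B.meas = 0) : IsInvLaplacian f (B.invLaplacian f) := by
  have h := exists_isInvLaplacian hf h0
  rw [invLaplacian, dif_pos h]
  exact h.choose_spec

theorem isInvLaplacian_fn (u : B.H1MeanZero) :
    IsInvLaplacian (fn u.1) (B.invLaplacian (fn u.1)) :=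
  isInvLaplacian_invLaplacian (Lp.memLp u.1.1.fst) u.2

theorem neg_inner_gradL2_invLaplacian (u : B.H1MeanZero) (ψ : B.H1) :
    -inner ℝ (B.gradL2 (B.invLaplacian (fn u.1))) (B.gradL2 ψ) =
      inner ℝ (B.toL2 u) (B.toL2 ψ) :=
  ((isInvLaplacian_iff (w := B.toL2 u) EventuallyEq.rfl).1 (isInvLaplacian_fn u)).2 ψ

theorem norm_toL2_le (u : B.H1) : ‖B.toL2 u‖ ≤ ‖u‖ := by
  rw [← abs_of_nonneg (norm_nonneg (B.toL2 u)), ← abs_of_nonneg (norm_nonneg u), ← sq_le_sq,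
    norm_sq_eq]
  exact le_add_of_nonneg_right (sq_nonneg _)

theorem exists_norm_invLaplacian_le (B : FlowDomain d) :
    ∃ C : ℝ, ∀ u : B.H1MeanZero, ‖B.invLaplacian (fn u.1)‖ ≤ C * ‖u‖ := by
  obtain ⟨C, hC, hP⟩ := B.exists_norm_sq_le
  refine ⟨C⁻¹, fun u => ?_⟩
  generalize hv : B.invLaplacian (fn u.1) = v
  have hv0 : v ∈ B.H1MeanZero := hv ▸ (isInvLaplacian_fn u).1
  have h1 : C * ‖v‖ ^ 2 ≤ ‖B.gradL2 v‖ ^ 2 := hP ⟨v, hv0⟩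
  have h2 := neg_inner_gradL2_invLaplacian u v
  rw [hv, real_inner_self_eq_norm_sq] at h2
  have h5 := neg_le_of_abs_le (abs_real_inner_le_norm (B.toL2 u) (B.toL2 v))
  have h6 : ‖B.toL2 u‖ * ‖B.toL2 v‖ ≤ ‖u‖ * ‖v‖ :=
    mul_le_mul (norm_toL2_le u.1) (norm_toL2_le v) (norm_nonneg _) (norm_nonneg _)
  have h4 : C * ‖v‖ ^ 2 ≤ ‖u‖ * ‖v‖ := by linarith
  rw [inv_mul_eq_div, le_div_iff₀ hC]
  rcases (norm_nonneg v).eq_or_lt with h7 | h7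
  · rw [← h7, zero_mul]; exact norm_nonneg _
  · refine le_of_mul_le_mul_right ?_ h7
    linarith

/-- The inverse Laplacian as a bounded operator on the functions of mean zero in `H¹(Ω)`. -/
def invLaplacianL (B : FlowDomain d) : B.H1MeanZero →L[ℝ] B.H1 :=
  LinearMap.mkContinuousOfExistsBound
    { toFun := fun u => B.invLaplacian (fn u.1)
      map_add' := fun u v => by
        refine (isInvLaplacian_fn (u + v)).unique
          ((isInvLaplacian_iff (w := B.toL2 (u + v : B.H1MeanZero)) EventuallyEq.rfl).2 ⟨?_, ?_⟩)
        · exact add_mem (isInvLaplacian_fn u).1 (isInvLaplacian_fn v).1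
        · intro ψ
          rw [map_add, inner_add_left, neg_add, neg_inner_gradL2_invLaplacian,
            neg_inner_gradL2_invLaplacian, Submodule.coe_add, map_add, inner_add_left]
      map_smul' := fun c u => by
        refine (isInvLaplacian_fn (c • u)).unique
          ((isInvLaplacian_iff (w := B.toL2 (c • u : B.H1MeanZero)) EventuallyEq.rfl).2 ⟨?_, ?_⟩)
        · exact B.H1MeanZero.smul_mem c (isInvLaplacian_fn u).1
        · intro ψ
          rw [RingHom.id_apply, map_smul, real_inner_smul_left, ← mul_neg,
            neg_inner_gradL2_invLaplacian, Submodule.coe_smul, map_smul, real_inner_smul_left] }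
    B.exists_norm_invLaplacian_le

theorem invLaplacianL_apply (u : B.H1MeanZero) : B.invLaplacianL u = B.invLaplacian (fn u.1) := rfl

/-- A multiplication operator from `H¹(Ω)` to `Lᵖ(Ω)` that is defined everywhere is bounded, by the
closed graph theorem. -/
theorem exists_clm_mul {p : ℝ≥0∞} [Fact (1 ≤ p)] {f : Space d → ℝ}
    (hf : ∀ ψ : B.H1, MemLp (fun x => f x * fn ψ x) p B.meas) :
    ∃ T : B.H1 →L[ℝ] Lp ℝ p B.meas, ∀ ψ, T ψ =ᵐ[B.meas] fun x => f x * fn ψ x := by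
  have hadd : ∀ u v : B.H1, fn (u + v) =ᵐ[B.meas] fun x => fn u x + fn v x := fun u v =>
    Lp.coeFn_add u.1.fst v.1.fst
  have hsmul : ∀ (c : ℝ) (u : B.H1), fn (c • u) =ᵐ[B.meas] fun x => c * fn u x := fun c u =>
    Lp.coeFn_smul c u.1.fst
  let T : B.H1 →ₗ[ℝ] Lp ℝ p B.meas :=
    { toFun := fun ψ => (hf ψ).toLp
      map_add' := fun u v => by
        rw [← MemLp.toLp_add]
        refine MemLp.toLp_congr _ _ ?_
        filter_upwards [hadd u v] with x hx
        rw [hx, Pi.add_apply, mul_add]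
      map_smul' := fun c u => by
        rw [RingHom.id_apply, ← MemLp.toLp_const_smul]
        refine MemLp.toLp_congr _ _ ?_
        filter_upwards [hsmul c u] with x hx
        rw [hx, Pi.smul_apply, smul_eq_mul]
        ring }
  have hgraph : ∀ (u : ℕ → B.H1) (x : B.H1) (y : Lp ℝ p B.meas), Tendsto u atTop (𝓝 x) →
      Tendsto (T ∘ u) atTop (𝓝 y) → y = T x := by
    intro u x y hu hy
    have h1 : TendstoInMeasure B.meas (fun n => (B.toL2 (u n) : Space d → ℝ)) atTop (B.toL2 x) :=
      tendstoInMeasure_of_tendsto_Lp (((B.toL2.continuous.tendsto x).comp hu))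
    -- along a subsequence, both `u n` and `T (u n) = f * u n` converge almost everywhere
    obtain ⟨ns, hns, h2⟩ := h1.exists_seq_tendsto_ae
    have h3 : TendstoInMeasure B.meas (fun n => (T (u (ns n)) : Space d → ℝ)) atTop y :=
      tendstoInMeasure_of_tendsto_Lp (hy.comp hns.tendsto_atTop)
    obtain ⟨ms, hms, h4⟩ := h3.exists_seq_tendsto_ae
    have h5 : ∀ᵐ z ∂B.meas, ∀ n, T (u n) z = f z * fn (u n) z :=
      ae_all_iff.2 fun n => (hf (u n)).coeFn_toLp
    refine Lp.ext ?_
    filter_upwards [h2, h4, h5, (hf x).coeFn_toLp] with z z2 z4 z5 z6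
    refine tendsto_nhds_unique z4 ?_
    rw [show T x z = f z * fn x z from z6]
    simp only [z5]
    exact (z2.comp hms.tendsto_atTop).const_mul (f z)
  exact ⟨ContinuousLinearMap.ofSeqClosedGraph (g := T) hgraph, fun ψ => (hf ψ).coeFn_toLp⟩

end FlowDomain

end

/-! ### Reduction of the linear system -/

section

variable {d : ℕ}

/-- The abstract form of the operator `-κ L + β D* D + γ T* T`, where `L` is an inverse of `-D* D`,
that is, an inverse Laplacian if `D` is a gradient. By `hL`, the first term is the form `κ ⟪D (L u),
D (L w)⟫`, symmetric and nonnegative; coercivity comes from the second term. -/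
theorem exists_coercive_form {V H H' : Type*} [NormedAddCommGroup V] [InnerProductSpace ℝ V]
    [NormedAddCommGroup H] [InnerProductSpace ℝ H] [NormedAddCommGroup H'] [InnerProductSpace ℝ H']
    (W : Submodule ℝ V) (L : W →L[ℝ] V) (J T : V →L[ℝ] H) (D : V →L[ℝ] H') {κ β γ C : ℝ}
    (hκ : 0 ≤ κ) (hβ : 0 ≤ β) (hγ : 0 ≤ γ)
    (hL : ∀ (u : W) (v : V), -inner ℝ (D (L u)) (D v) = inner ℝ (J u) (J v))
    (hD : ∀ u : W, C * ‖u‖ ^ 2 ≤ ‖D u‖ ^ 2) :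
    ∃ A : W →L[ℝ] W →L[ℝ] ℝ, (∀ u w : W, A u w =
      -κ * inner ℝ (J (L u)) (J w) + (β * inner ℝ (D u) (D w) + γ * inner ℝ (T u) (T w))) ∧
      (∀ u w, A u w = A w u) ∧ ∀ u, β * C * ‖u‖ ^ 2 ≤ A u u := by
  obtain ⟨A, hA⟩ : ∃ A : W →L[ℝ] W →L[ℝ] ℝ, ∀ u w : W, A u w =
      -κ * inner ℝ (J (L u)) (J w) + (β * inner ℝ (D u) (D w) + γ * inner ℝ (T u) (T w)) :=
    ⟨-κ • innerComp (J.comp L) (J.comp W.subtypeL) +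
      (β • innerComp (D.comp W.subtypeL) (D.comp W.subtypeL) +
        γ • innerComp (T.comp W.subtypeL) (T.comp W.subtypeL)), fun _ _ => rfl⟩
  have hneg : ∀ u w : W, -κ * inner ℝ (J (L u)) (J w) = κ * inner ℝ (D (L w)) (D (L u)) :=
    fun u w => by rw [real_inner_comm (J w), ← hL]; ring
  refine ⟨A, hA, fun u w => ?_, fun u => ?_⟩
  · rw [hA, hA, hneg, hneg, real_inner_comm (D (L w)), real_inner_comm (D u),
      real_inner_comm (T u)]
  · rw [hA, hneg, real_inner_self_eq_norm_sq, real_inner_self_eq_norm_sq,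
      real_inner_self_eq_norm_sq, mul_assoc]
    have h1 := mul_le_mul_of_nonneg_left (hD u) hβ
    have h2 := mul_nonneg hκ (sq_nonneg ‖D (L u)‖)
    have h3 := mul_nonneg hγ (sq_nonneg ‖T u‖)
    linarith

theorem existsUnique_forall_eq_of_coercive {V : Type*} [NormedAddCommGroup V]
    [InnerProductSpace ℝ V] (W : Submodule ℝ V) [CompleteSpace W] {A : W →L[ℝ] W →L[ℝ] ℝ} {c : ℝ}
    (hc : 0 < c) (hA : ∀ v, c * ‖v‖ ^ 2 ≤ A v v) (l : V →L[ℝ] ℝ) : ∃! v, ∀ w : W, A v w = l w := by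
  obtain ⟨v, hv⟩ := exists_forall_eq_of_coercive hc hA (l.comp W.subtypeL)
  refine ⟨v, hv, fun v' hv' => sub_eq_zero.1 ?_⟩
  have h0 : A (v' - v) (v' - v) = 0 := by
    have e : A (v' - v) = A v' - A v := map_sub A v' v
    rw [e, sub_apply, hv', hv]
    exact sub_self _
  have h1 := hA (v' - v)
  rw [h0] at h1
  have h2 : ‖v' - v‖ ^ 2 ≤ 0 := by
    by_contra! h3
    linarith [mul_pos hc h3]
  exact norm_eq_zero.1 (sq_eq_zero_iff.1 (le_antisymm h2 (sq_nonneg _)))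

namespace FlowDomain

variable {B : FlowDomain d}

theorem coe_smul_oneH1 (c : ℝ) : (c • B.toL2 B.oneH1 : B.L2) =ᵐ[B.meas] fun _ => c := by
  filter_upwards [Lp.coeFn_smul c (B.toL2 B.oneH1), B.fn_oneH1] with x h1 h2
  rw [h1, Pi.smul_apply]
  change c • fn B.oneH1 x = c
  rw [h2, smul_eq_mul, mul_one]

theorem inner_eq_meanValue_mul (r : B.L2) :
    inner ℝ r (B.toL2 B.oneH1) = meanValue r * inner ℝ (B.toL2 B.oneH1) (B.toL2 B.oneH1) := by
  have h : inner ℝ (B.toL2 B.oneH1) (B.toL2 B.oneH1) = B.meas.real univ := by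
    rw [inner_oneH1]
    refine (integral_congr_ae B.fn_oneH1).trans ?_
    simp
  have h0 := (inner_oneH1_oneH1_pos (B := B)).ne'
  rw [h] at h0 ⊢
  rw [inner_oneH1, meanValue, average_eq, smul_eq_mul]
  field_simp

theorem inner_oneH1_of_mem {u : B.H1} (hu : u ∈ B.H1MeanZero) :
    inner ℝ (B.toL2 B.oneH1) (B.toL2 u) = 0 := by
  rw [real_inner_comm]; exact mem_H1MeanZero_iff.1 hu

theorem formP_eq {β η : ℝ} {G : Space d → ℝ} {T : B.H1 →L[ℝ] B.L2}
    (hT : ∀ ψ, T ψ =ᵐ[B.meas] fun x => G x * fn ψ x) (ρ ψ : B.H1) :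
    formP β η G ρ ψ =
      β * inner ℝ (B.gradL2 ρ) (B.gradL2 ψ) + 2 / η ^ 2 * inner ℝ (T ρ) (T ψ) := by
  rw [formP, dirichlet_eq_inner, ← inner_L2_eq_pair]
  congr 2
  refine integral_congr_ae ?_
  filter_upwards [hT ρ, hT ψ] with x h1 h2
  rw [h1, h2]
  ring

/-- A source term that can be paired with all of `H¹(Ω)` is a bounded functional, as multiplication
by it is bounded from `H¹(Ω)` to `L¹(Ω)`. -/
theorem exists_clm_pair {g : Space d → ℝ}
    (hg : ∀ ψ : B.H1, Integrable (fun x => g x * fn ψ x) B.meas) :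
    ∃ l : B.H1 →L[ℝ] ℝ, ∀ ψ, B.pair g (fn ψ) = l ψ := by
  obtain ⟨S, hS⟩ := exists_clm_mul (p := 1) fun ψ => memLp_one_iff_integrable.2 (hg ψ)
  refine ⟨(L1.integralCLM (μ := B.meas)).comp S, fun ψ => ?_⟩
  have h1 : L1.integralCLM (S ψ) = ∫ x, S ψ x ∂B.meas := by
    rw [← L1.integral_eq, L1.integral_eq_integral]
  rw [ContinuousLinearMap.comp_apply, h1, integral_congr_ae (hS ψ)]
  rfl

end FlowDomain

open FlowDomain

variable {B : FlowDomain d} {β η θ ρs M δt : ℝ} {ρn Vn : B.L2} {φn : B.H1}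

/-- The function `Δ⁻¹ f` with `f = (M δt)⁻¹ (ρⁿ - V_ρ)`, which is determined by the data. -/
def dataPotential (M δt : ℝ) (ρn : B.L2) : B.H1 :=
  B.invLaplacian (fun x => 1 / (M * δt) * (ρn x - meanValue ρn))

/-- The defining property of `dataPotential`, with the function `ρⁿ - V_ρ` written out in `L²(Ω)`.
-/
theorem dataPotential_spec (M δt : ℝ) (ρn : B.L2) :
    dataPotential M δt ρn ∈ B.H1MeanZero ∧ ∀ ψ,
      -inner ℝ (B.gradL2 (dataPotential M δt ρn)) (B.gradL2 ψ) =
        1 / (M * δt) * (inner ℝ ρn (B.toL2 ψ) -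
          meanValue ρn * inner ℝ (B.toL2 B.oneH1) (B.toL2 ψ)) := by
  set w : B.L2 := (1 / (M * δt)) • (ρn - meanValue ρn • B.toL2 B.oneH1) with hwdef
  have hw : w =ᵐ[B.meas] fun x => 1 / (M * δt) * (ρn x - meanValue ρn) := by
    filter_upwards [Lp.coeFn_smul (1 / (M * δt)) (ρn - meanValue ρn • B.toL2 B.oneH1),
      Lp.coeFn_sub ρn (meanValue ρn • B.toL2 B.oneH1), coe_smul_oneH1 (B := B) (meanValue ρn)]
      with x h1 h2 h3
    rw [hwdef, h1, Pi.smul_apply, h2, Pi.sub_apply, h3, smul_eq_mul]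
  have h0 : ∫ x, 1 / (M * δt) * (ρn x - meanValue ρn) ∂B.meas = 0 := by
    rw [← integral_congr_ae hw, ← inner_oneH1, hwdef, real_inner_smul_left, inner_sub_left,
      real_inner_smul_left, inner_eq_meanValue_mul]
    ring
  have h := (isInvLaplacian_iff hw).1
    (isInvLaplacian_invLaplacian ((memLp_congr_ae hw).1 (Lp.memLp w)) h0)
  refine ⟨h.1, fun ψ => ?_⟩
  rw [dataPotential, h.2 ψ, hwdef, real_inner_smul_left, inner_sub_left, real_inner_smul_left]

/-- The right-hand side of the reduced equation as a bounded functional: `q` stands for `Δ⁻¹ f`, `T`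
for multiplication by `Gⁿ`, `l` for the pairing with `g₁ⁿ`, and `c` for `(2 / η²) V_ρ`. -/
def rhsL (c : ℝ) (q : B.H1) (T : B.H1 →L[ℝ] B.L2) (l : B.H1 →L[ℝ] ℝ) : B.H1 →L[ℝ] ℝ :=
  -((innerSL ℝ (B.toL2 q)).comp B.toL2) - l - c • (innerSL ℝ (T B.oneH1)).comp T

theorem rhsL_apply (c : ℝ) (q : B.H1) (T : B.H1 →L[ℝ] B.L2) (l : B.H1 →L[ℝ] ℝ) (ψ : B.H1) :
    rhsL c q T l ψ = -inner ℝ (B.toL2 q) (B.toL2 ψ) - l ψ - c * inner ℝ (T B.oneH1) (T ψ) := rfl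

/-- The mass equation determines the mean value of `ρ`, and determines `μ` up to a constant from
`ρ`. -/
theorem mass_iff (hM : 0 < M) (hδt : 0 < δt) (ρ μ : B.H1) :
    (∀ ψ : B.H1, 1 / δt * B.pair (fn ρ) (fn ψ) =
      -M * dirichlet μ ψ + 1 / δt * B.pair ρn (fn ψ)) ↔
    ∃ (ρ₀ : B.H1MeanZero) (m : ℝ), ρ = ρ₀ + meanValue ρn • B.oneH1 ∧
      μ = (1 / (M * δt)) • B.invLaplacian (fn ρ₀.1) - dataPotential M δt ρn + m • B.oneH1 := by
  obtain ⟨hq, hq'⟩ := dataPotential_spec M δt ρn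
  simp only [pair_fn_fn, dirichlet_eq_inner, pair_fn_eq_inner (v := ρn) EventuallyEq.rfl]
  have hdir : ∀ (ρ₀ : B.H1MeanZero) (ψ : B.H1), inner ℝ (B.gradL2
      ((1 / (M * δt)) • B.invLaplacian (fn ρ₀.1) - dataPotential M δt ρn)) (B.gradL2 ψ) =
      1 / (M * δt) * (inner ℝ ρn (B.toL2 ψ) -
        inner ℝ (B.toL2 (ρ₀ + meanValue ρn • B.oneH1)) (B.toL2 ψ)) := by
    intro ρ₀ ψ
    have h1 := neg_inner_gradL2_invLaplacian ρ₀ ψ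
    have h2 := hq' ψ
    rw [map_sub, map_smul, inner_sub_left, real_inner_smul_left, map_add, map_smul, inner_add_left,
      real_inner_smul_left, ← h1]
    linarith
  constructor
  · intro h
    -- the constant test function shows that `ρ` and `ρⁿ` have the same mean value
    have h1 := h B.oneH1
    rw [gradL2_oneH1, inner_zero_right, mul_zero, zero_add] at h1
    have h2 : inner ℝ (B.toL2 ρ) (B.toL2 B.oneH1) = inner ℝ ρn (B.toL2 B.oneH1) :=
      mul_left_cancel₀ (one_div_pos.2 hδt).ne' h1
    have h3 : ρ - meanValue ρn • B.oneH1 ∈ B.H1MeanZero := by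
      rw [mem_H1MeanZero_iff, map_sub, map_smul, inner_sub_left, real_inner_smul_left, h2,
        inner_eq_meanValue_mul, sub_self]
    obtain ⟨μ₀, m, hμ⟩ := exists_eq_add_smul_oneH1 μ
    refine ⟨⟨_, h3⟩, m, by simp, ?_⟩
    rw [hμ]
    congr 1
    set ρ₀ : B.H1MeanZero := ⟨_, h3⟩ with hρ₀
    have hmem : (1 / (M * δt)) • B.invLaplacian (fn ρ₀.1) - dataPotential M δt ρn
        ∈ B.H1MeanZero := sub_mem (Submodule.smul_mem _ _ (isInvLaplacian_fn ρ₀).1) hq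
    refine eq_of_forall_inner_gradL2_eq μ₀.2 hmem fun ψ => ?_
    rw [hdir]
    have h4 := h ψ
    have h5 : B.gradL2 μ = B.gradL2 μ₀.1 := by
      rw [hμ, map_add, map_smul, gradL2_oneH1, smul_zero, add_zero]
    have h6 : ρ₀.1 + meanValue ρn • B.oneH1 = ρ := by simp [hρ₀]
    rw [h5] at h4
    rw [h6]
    field_simp at h4 ⊢
    linarith
  · rintro ⟨ρ₀, m, rfl, rfl⟩ ψ
    rw [map_add B.gradL2, map_smul B.gradL2 m, gradL2_oneH1, smul_zero, add_zero, hdir]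
    field_simp
    ring

/-- For `ρ` and `μ` of the form given by the mass equation, the equation for the potential splits
into its part for test functions of mean zero, which is the reduced equation, and its part for
constants, which fixes the mean value of `μ`. -/
theorem potential_iff {T : B.H1 →L[ℝ] B.L2} {l : B.H1 →L[ℝ] ℝ}
    (hT : ∀ ψ, T ψ =ᵐ[B.meas] fun x => coeffG ρs ρn x * fn ψ x)
    (hl : ∀ ψ, B.pair (sourceG η θ ρs ρn Vn φn) (fn ψ) = l ψ) {ρ μ : B.H1} {ρ₀ : B.H1MeanZero}
    {m : ℝ} (hρ : ρ = ρ₀ + meanValue ρn • B.oneH1)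
    (hμ : μ = (1 / (M * δt)) • B.invLaplacian (fn ρ₀.1) - dataPotential M δt ρn + m • B.oneH1) :
    (∀ ψ : B.H1, B.pair (fn μ) (fn ψ) =
      formP β η (coeffG ρs ρn) ρ ψ + B.pair (sourceG η θ ρs ρn Vn φn) (fn ψ)) ↔
    (∀ ψ : B.H1MeanZero, formA β η M δt (coeffG ρs ρn) ρ₀.1 ψ.1 =
      rhsL (2 / η ^ 2 * meanValue ρn) (dataPotential M δt ρn) T l ψ) ∧
      m * inner ℝ (B.toL2 B.oneH1) (B.toL2 B.oneH1) =
        2 / η ^ 2 * inner ℝ (T ρ) (T B.oneH1) + l B.oneH1 := by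
  have hL := (isInvLaplacian_fn ρ₀).1
  have hq := (dataPotential_spec M δt ρn).1
  simp only [formA, formP_eq hT, hl, pair_fn_fn, rhsL_apply]
  have h0 : ∀ ψ : B.H1MeanZero, inner ℝ (B.toL2 μ) (B.toL2 ψ) =
      β * inner ℝ (B.gradL2 ρ) (B.gradL2 ψ) + 2 / η ^ 2 * inner ℝ (T ρ) (T ψ) + l ψ ↔
      -(1 / (M * δt)) * inner ℝ (B.toL2 (B.invLaplacian (fn ρ₀.1))) (B.toL2 ψ) +
        (β * inner ℝ (B.gradL2 ρ₀) (B.gradL2 ψ) + 2 / η ^ 2 * inner ℝ (T ρ₀) (T ψ)) =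
      -inner ℝ (B.toL2 (dataPotential M δt ρn)) (B.toL2 ψ) - l ψ -
        2 / η ^ 2 * meanValue ρn * inner ℝ (T B.oneH1) (T ψ) := by
    intro ψ
    have e1 : inner ℝ (B.toL2 μ) (B.toL2 ψ) =
        1 / (M * δt) * inner ℝ (B.toL2 (B.invLaplacian (fn ρ₀.1))) (B.toL2 ψ) -
          inner ℝ (B.toL2 (dataPotential M δt ρn)) (B.toL2 ψ) := by
      rw [hμ, map_add, map_sub, map_smul, map_smul, inner_add_left, inner_sub_left,
        real_inner_smul_left, real_inner_smul_left, inner_oneH1_of_mem ψ.2, mul_zero, add_zero]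
    have e2 : B.gradL2 ρ = B.gradL2 ρ₀ := by
      rw [hρ, map_add, map_smul, gradL2_oneH1, smul_zero, add_zero]
    have e3 : inner ℝ (T ρ) (T ψ) =
        inner ℝ (T ρ₀) (T ψ) + meanValue ρn * inner ℝ (T B.oneH1) (T ψ) := by
      rw [hρ, map_add, map_smul, inner_add_left, real_inner_smul_left]
    rw [e1, e2, e3]
    constructor <;> intro h <;> linarith
  have h1 : inner ℝ (B.toL2 μ) (B.toL2 B.oneH1) =
      m * inner ℝ (B.toL2 B.oneH1) (B.toL2 B.oneH1) := by
    rw [hμ, map_add, map_sub, map_smul, map_smul, inner_add_left, inner_sub_left,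
      real_inner_smul_left, real_inner_smul_left, mem_H1MeanZero_iff.1 hL, mem_H1MeanZero_iff.1 hq]
    ring
  constructor
  · intro h
    refine ⟨fun ψ => (h0 ψ).1 (h ψ), ?_⟩
    rw [← h1, h, gradL2_oneH1, inner_zero_right, mul_zero, zero_add]
  · rintro ⟨h, hm⟩ ψ
    obtain ⟨ψ₀, c, rfl⟩ := exists_eq_add_smul_oneH1 ψ
    have h2 := (h0 ψ₀).2 (h ψ₀)
    rw [← h1] at hm
    simp only [map_add, map_smul, inner_add_right, real_inner_smul_right, gradL2_oneH1,
      inner_zero_right, h2, hm, smul_eq_mul]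
    ring

theorem rhsB_eq {T : B.H1 →L[ℝ] B.L2} {l : B.H1 →L[ℝ] ℝ}
    (hT : ∀ ψ, T ψ =ᵐ[B.meas] fun x => coeffG ρs ρn x * fn ψ x)
    (hg : ∀ ψ : B.H1, Integrable (fun x => sourceG η θ ρs ρn Vn φn x * fn ψ x) B.meas)
    (hl : ∀ ψ, B.pair (sourceG η θ ρs ρn Vn φn) (fn ψ) = l ψ) (ψ : B.H1) :
    rhsB η θ ρs M δt ρn Vn φn ψ =
      rhsL (2 / η ^ 2 * meanValue ρn) (dataPotential M δt ρn) T l ψ := by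
  have h1 : ∫ x, 2 / η ^ 2 * meanValue ρn * (T B.oneH1 x * T ψ x) ∂B.meas =
      2 / η ^ 2 * meanValue ρn * inner ℝ (T B.oneH1) (T ψ) := by
    rw [integral_const_mul, ← inner_L2_eq_pair]; rfl
  have h2 : B.pair (fun x => sourceG η θ ρs ρn Vn φn x
      + 2 / η ^ 2 * coeffG ρs ρn x ^ 2 * meanValue ρn) (fn ψ) =
      l ψ + 2 / η ^ 2 * meanValue ρn * inner ℝ (T B.oneH1) (T ψ) := by
    rw [← hl, ← h1]
    refine Eq.trans (integral_congr_ae ?_) (integral_add (hg ψ)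
      (((Lp.memLp (T B.oneH1)).integrable_mul (Lp.memLp (T ψ))).const_mul
        (2 / η ^ 2 * meanValue ρn)))
    filter_upwards [hT B.oneH1, hT ψ, B.fn_oneH1] with x h3 h4 h5
    rw [h3, h4, h5]
    ring
  rw [rhsB, h2, pair_fn_fn, rhsL_apply]
  change -inner ℝ (B.toL2 (dataPotential M δt ρn)) (B.toL2 ψ) - _ = _
  ring

/-- The weak solutions of the system correspond to the solutions of the reduced equation together
with the constant `m`, for which the last line is an equation with nonzero leading coefficient. -/
theorem isWeakSolution_iff (hM : 0 < M) (hδt : 0 < δt) {T : B.H1 →L[ℝ] B.L2} {l : B.H1 →L[ℝ] ℝ}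
    (hT : ∀ ψ, T ψ =ᵐ[B.meas] fun x => coeffG ρs ρn x * fn ψ x)
    (hl : ∀ ψ, B.pair (sourceG η θ ρs ρn Vn φn) (fn ψ) = l ψ) (ρ μ : B.H1) :
    IsWeakSolution β η θ ρs M δt ρn Vn φn ρ μ ↔ ∃ (ρ₀ : B.H1MeanZero) (m : ℝ),
      ρ = ρ₀ + meanValue ρn • B.oneH1 ∧
      μ = (1 / (M * δt)) • B.invLaplacian (fn ρ₀.1) - dataPotential M δt ρn + m • B.oneH1 ∧
      (∀ ψ : B.H1MeanZero, formA β η M δt (coeffG ρs ρn) ρ₀.1 ψ.1 =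
        rhsL (2 / η ^ 2 * meanValue ρn) (dataPotential M δt ρn) T l ψ) ∧
      m * inner ℝ (B.toL2 B.oneH1) (B.toL2 B.oneH1) =
        2 / η ^ 2 * inner ℝ (T ρ) (T B.oneH1) + l B.oneH1 := by
  constructor
  · rintro ⟨h1, h2⟩
    obtain ⟨ρ₀, m, hρ, hμ⟩ := (mass_iff hM hδt ρ μ).1 h1
    exact ⟨ρ₀, m, hρ, hμ, (potential_iff hT hl hρ hμ).1 h2⟩
  · rintro ⟨ρ₀, m, hρ, hμ, h⟩
    exact ⟨(mass_iff hM hδt ρ μ).2 ⟨ρ₀, m, hρ, hμ⟩, (potential_iff hT hl hρ hμ).2 h⟩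

theorem existsUnique_isWeakSolution (hM : 0 < M) (hδt : 0 < δt) {T : B.H1 →L[ℝ] B.L2}
    {l : B.H1 →L[ℝ] ℝ} (hT : ∀ ψ, T ψ =ᵐ[B.meas] fun x => coeffG ρs ρn x * fn ψ x)
    (hl : ∀ ψ, B.pair (sourceG η θ ρs ρn Vn φn) (fn ψ) = l ψ)
    (hA : ∃! ρ₀ : B.H1MeanZero, ∀ ψ : B.H1MeanZero, formA β η M δt (coeffG ρs ρn) ρ₀.1 ψ.1 =
      rhsL (2 / η ^ 2 * meanValue ρn) (dataPotential M δt ρn) T l ψ) :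
    ∃! p : B.H1 × B.H1, IsWeakSolution β η θ ρs M δt ρn Vn φn p.1 p.2 := by
  obtain ⟨ρ₀, hρ₀, huniq⟩ := hA
  have hone := (inner_oneH1_oneH1_pos (B := B)).ne'
  set ρ : B.H1 := ρ₀ + meanValue ρn • B.oneH1 with hρ
  set m : ℝ := (2 / η ^ 2 * inner ℝ (T ρ) (T B.oneH1) + l B.oneH1) /
    inner ℝ (B.toL2 B.oneH1) (B.toL2 B.oneH1) with hm
  refine ⟨(ρ, (1 / (M * δt)) • B.invLaplacian (fn ρ₀.1) - dataPotential M δt ρn + m • B.oneH1),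
    (isWeakSolution_iff hM hδt hT hl _ _).2
      ⟨ρ₀, m, hρ, rfl, hρ₀, div_mul_cancel₀ _ hone⟩, ?_⟩
  rintro ⟨ρ', μ'⟩ h
  obtain ⟨ρ₀', m', hρ', hμ', h3, h4⟩ := (isWeakSolution_iff hM hδt hT hl _ _).1 h
  have h5 : ρ₀' = ρ₀ := huniq _ h3
  subst h5
  have h7 : ρ' = ρ := hρ'
  have h8 : m' = m := by
    rw [hm, eq_div_iff hone, ← h7]
    exact h4
  rw [Prod.mk.injEq]
  exact ⟨h7, hμ'.trans (by rw [h8])⟩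

theorem fn_eq_sub_of_eq_add {ρ ρ₀ : B.H1} {c : ℝ} (h : ρ = ρ₀ + c • B.oneH1) :
    ∀ᵐ x ∂B.meas, fn ρ₀ x = fn ρ x - c := by
  have h4 : B.toL2 ρ = B.toL2 ρ₀ + c • B.toL2 B.oneH1 := by rw [h, map_add, map_smul]
  change ∀ᵐ x ∂B.meas, B.toL2 ρ₀ x = B.toL2 ρ x - c
  rw [h4]
  filter_upwards [Lp.coeFn_add (B.toL2 ρ₀) (c • B.toL2 B.oneH1), coe_smul_oneH1 (B := B) c]
    with x h5 h6
  rw [h5, Pi.add_apply, h6, add_sub_cancel_right]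

theorem exists_clm_formA (hβ : 0 < β) (hη : 0 < η) (hM : 0 < M) (hδt : 0 < δt) {G : Space d → ℝ}
    {T : B.H1 →L[ℝ] B.L2} (hT : ∀ ψ, T ψ =ᵐ[B.meas] fun x => G x * fn ψ x) :
    ∃ A : B.H1MeanZero →L[ℝ] (B.H1MeanZero →L[ℝ] ℝ),
      (∀ ρ ψ : B.H1MeanZero, A ρ ψ = formA β η M δt G ρ.1 ψ.1) ∧
      (∀ ρ₁ ρ₂ : B.H1MeanZero, A ρ₁ ρ₂ = A ρ₂ ρ₁) ∧
      ∃ c : ℝ, 0 < c ∧ ∀ ρ : B.H1MeanZero, c * ‖ρ‖ ^ 2 ≤ A ρ ρ := by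
  obtain ⟨C, hC, hP⟩ := B.exists_norm_sq_le
  have hκ : 0 < 1 / (M * δt) := one_div_pos.2 (mul_pos hM hδt)
  have hη2 : 0 < 2 / η ^ 2 := by positivity
  obtain ⟨A, hA, hsymm, hcoer⟩ := exists_coercive_form B.H1MeanZero B.invLaplacianL B.toL2 T
    B.gradL2 hκ.le hβ.le hη2.le neg_inner_gradL2_invLaplacian hP
  refine ⟨A, fun ρ ψ => ?_, hsymm, β * C, mul_pos hβ hC, hcoer⟩
  rw [hA, formA, formP_eq hT, pair_fn_fn, invLaplacianL_apply]

end

end Surfactant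

end

open Surfactant Surfactant.FlowDomain in
theorem theorem3p1 {d : ℕ} (hd : 0 < d) (B : FlowDomain d) (β η θ ρs M δt : ℝ)
    (hβ : 0 < β) (hη : 0 < η) (hM : 0 < M) (hδt : 0 < δt)
    (ρn Vn : B.L2) (φn : B.H1)
    (hG : ∀ ψ : B.H1, MemLp (fun x => coeffG ρs ρn x * fn ψ x) 2 B.meas)
    (hg : ∀ ψ : B.H1, Integrable (fun x => sourceG η θ ρs ρn Vn φn x * fn ψ x) B.meas) :
    -- the linear system has exactly one solution
    (∃! p : B.H1 × B.H1, IsWeakSolution β η θ ρs M δt ρn Vn φn p.1 p.2) ∧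
    -- the inverse Laplacian is well defined on mean-zero functions
    (∀ u : Space d → ℝ, MemLp u 2 B.meas → ∫ x, u x ∂B.meas = 0 →
      IsInvLaplacian u (B.invLaplacian u) ∧
        ∀ v : B.H1, IsInvLaplacian u v → v = B.invLaplacian u) ∧
    -- the associated operator from mean-zero functions to their dual
    ∃ A : B.H1MeanZero →L[ℝ] (B.H1MeanZero →L[ℝ] ℝ),
      (∀ ρ ψ : B.H1MeanZero, A ρ ψ = formA β η M δt (coeffG ρs ρn) ρ.1 ψ.1) ∧
      -- it is the operator of the linear system, after removal of the mean value
      (∀ ρ μ : B.H1, IsWeakSolution β η θ ρs M δt ρn Vn φn ρ μ →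
        ∃ ρhat : B.H1MeanZero,
          (∀ᵐ x ∂B.meas, fn ρhat.1 x = fn ρ x - meanValue ρn) ∧
          ∀ ψ : B.H1MeanZero, A ρhat ψ = rhsB η θ ρs M δt ρn Vn φn ψ.1) ∧
      -- it is symmetric and positive definite, indeed coercive
      (∀ ρ₁ ρ₂ : B.H1MeanZero, A ρ₁ ρ₂ = A ρ₂ ρ₁) ∧
      (∀ ρ : B.H1MeanZero, ρ ≠ 0 → 0 < A ρ ρ) ∧
      ∃ c : ℝ, 0 < c ∧ ∀ ρ : B.H1MeanZero, c * ‖ρ‖ ^ 2 ≤ A ρ ρ := by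
  obtain ⟨T, hT⟩ := exists_clm_mul (p := 2) hG
  obtain ⟨l, hl⟩ := exists_clm_pair hg
  obtain ⟨A, hA, hsymm, c, hc, hcoer⟩ := exists_clm_formA hβ hη hM hδt hT
  refine ⟨existsUnique_isWeakSolution hM hδt hT hl ?_, fun u hu hu0 => ?_, A, hA, ?_, hsymm, ?_,
    c, hc, hcoer⟩
  · simp only [← hA]
    exact existsUnique_forall_eq_of_coercive B.H1MeanZero hc hcoer _
  · have h := isInvLaplacian_invLaplacian hu hu0
    exact ⟨h, fun v hv => hv.unique h⟩
  · intro ρ μ h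
    obtain ⟨ρ₀, m, hρ, -, h1, -⟩ := (isWeakSolution_iff hM hδt hT hl ρ μ).1 h
    exact ⟨ρ₀, fn_eq_sub_of_eq_add hρ, fun ψ => by rw [hA, rhsB_eq hT hg hl, h1]⟩
  · exact fun ρ hρ => (mul_pos hc (pow_pos (norm_pos_iff.2 hρ) 2)).trans_le (hcoer ρ)
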